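/- Let $k$ be an algebraically closed field of characteristic zero, let $r\ge 1$, let $S=k[x_0,\dots,x_r]$, and let $X\subset\mathbb{P}^r=\mathbb{P}^r(k)$ be a finite set of exactly $s$ points. Let $I\subset S$ be the homogeneous ideal of $X$, i.e. the ideal generated by all homogeneous polynomials vanishing at every point of $X$. Let $\operatorname{gin}_{\mathrm{lex}} I$ be the generic initial ideal of $I$ for the degree-compatible lexicographic term order with $x_0>x_1>\dots>x_r$; that is, the unique ideal $J$ for which there is a dense Zariski open subset $U\subseteq \mathrm{GL}_{r+1}(k)$ such that $\operatorname{in}_{\mathrm{lex}}(g\cdot I)=J$ for all $g\in U$. Then $\operatorname{gin}_{\mathrm{lex}} I$ exists, is unique, and its Castelnuovo–Mumford regularity is $$\operatorname{reg}\,\operatorname{gin}_{\mathrm{lex}} I = s .$$ Here, for a homogeneous ideal $J$ with minimal graded free resolution $$0\to \bigoplus_j S(-a_{lj})\to\cdots\to\bigoplus_j S(-a_{1j})\to\bigoplus_j S(-a_{0j})\to J\to 0,$$ $\operatorname{reg} J$ is the least integer $d$ such that $a_{ij}\le d+i$ for all $i,j$. -/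

import Mathlib

open scoped LinearAlgebra.Projectivization

namespace LexGin

variable {k : Type*} [Field k] {n : ℕ}

/-! ### Ideals of points in projective space -/

/-- The homogeneous ideal of a set `X` of points of projective space: the ideal generated by the
homogeneous polynomials that vanish at every point of `X` (at all of its homogeneous
coordinates). -/
noncomputable def idealOfPoints (X : Set (ℙ k (Fin n → k))) : Ideal (MvPolynomial (Fin n) k) :=
  Ideal.span {f | (∃ d : ℕ, f.IsHomogeneous d) ∧
    ∀ (v : Fin n → k) (hv : v ≠ 0), Projectivization.mk k v hv ∈ X → MvPolynomial.eval v f = 0}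

/-! ### Initial ideals and generic initial ideals -/

/-- The initial ideal of `I`: the ideal generated by the leading terms of the elements of `I`. -/
noncomputable def initialIdeal (τ : MonomialOrder (Fin n)) (I : Ideal (MvPolynomial (Fin n) k)) :
    Ideal (MvPolynomial (Fin n) k) :=
  Ideal.span (τ.leadingTerm '' (I : Set (MvPolynomial (Fin n) k)))

/-- The linear change of coordinates `x_j ↦ ∑ i, g i j • x_i` given by an invertible matrix `g`. -/
noncomputable def changeCoords (g : GL (Fin n) k) :
    MvPolynomial (Fin n) k →ₐ[k] MvPolynomial (Fin n) k :=
  MvPolynomial.aeval fun j => ∑ i, MvPolynomial.C (g i j) * MvPolynomial.X i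

/-- The ideal `g · I`. -/
noncomputable def transform (g : GL (Fin n) k) (I : Ideal (MvPolynomial (Fin n) k)) :
    Ideal (MvPolynomial (Fin n) k) :=
  I.map (changeCoords g)

/-- Zariski open subsets of `GL_n(k)`: complements of the common zero sets of families of
polynomials in the matrix entries. -/
def IsZariskiOpen (U : Set (GL (Fin n) k)) : Prop :=
  ∃ T : Set (MvPolynomial (Fin n × Fin n) k),
    U = {g | ∃ p ∈ T, MvPolynomial.eval (fun ij : Fin n × Fin n => g ij.1 ij.2) p ≠ 0}

/-- Zariski dense subsets of `GL_n(k)`: those meeting every nonempty Zariski open subset. -/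
def IsZariskiDense (U : Set (GL (Fin n) k)) : Prop :=
  ∀ V : Set (GL (Fin n) k), IsZariskiOpen V → V.Nonempty → (U ∩ V).Nonempty

/-- `J` is the generic initial ideal of `I` with respect to `τ`: there is a dense Zariski open
subset of `GL_n(k)` on which the initial ideal of `g · I` is constantly equal to `J`. -/
def IsGin (τ : MonomialOrder (Fin n)) (I J : Ideal (MvPolynomial (Fin n) k)) : Prop :=
  ∃ U : Set (GL (Fin n) k), IsZariskiOpen U ∧ IsZariskiDense U ∧
    ∀ g ∈ U, initialIdeal τ (transform g I) = J

/-! ### Minimal graded free resolutions and Castelnuovo-Mumford regularity -/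

/-- `f` lies in the degree `e` part of the standard graded polynomial ring, where `e` is an
integer (the part is zero for `e < 0`). -/
def IsForm (f : MvPolynomial (Fin n) k) (e : ℤ) : Prop :=
  ∀ m ∈ f.support, (m.degree : ℤ) = e

/-- A minimal graded free resolution
`0 → ⨁ j, S(-a l j) → ⋯ → ⨁ j, S(-a 1 j) → ⨁ j, S(-a 0 j) → J → 0` of an ideal `J` of
`S = k[x_1, …, x_n]`, with `a i j = shift i j`. The `i`-th free module is `S ^ (rank i)`, and its
`j`-th basis vector `Pi.single j 1` has degree `shift i j`. -/
structure MinimalGradedFreeResolution (J : Ideal (MvPolynomial (Fin n) k)) where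
  /-- the ranks of the free modules -/
  rank : ℕ → ℕ
  /-- the length of the resolution -/
  length : ℕ
  rank_eq_zero : ∀ i, length < i → rank i = 0
  /-- the degrees of the basis elements -/
  shift : (i : ℕ) → Fin (rank i) → ℤ
  /-- the augmentation onto `J` -/
  aug : (Fin (rank 0) → MvPolynomial (Fin n) k) →ₗ[MvPolynomial (Fin n) k]
    MvPolynomial (Fin n) k
  /-- the differentials -/
  diff : (i : ℕ) → (Fin (rank (i + 1)) → MvPolynomial (Fin n) k) →ₗ[MvPolynomial (Fin n) k]
    (Fin (rank i) → MvPolynomial (Fin n) k)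
  /-- the augmentation is homogeneous of degree zero -/
  aug_isForm : ∀ j, IsForm (aug (Pi.single j 1)) (shift 0 j)
  /-- the differentials are homogeneous of degree zero -/
  diff_isForm : ∀ i j l, IsForm (diff i (Pi.single j 1) l) (shift (i + 1) j - shift i l)
  range_aug : LinearMap.range aug = J
  exact_zero : Function.Exact (diff 0) aug
  exact_succ : ∀ i, Function.Exact (diff (i + 1)) (diff i)
  /-- minimality: the entries of the differentials lie in the irrelevant maximal ideal -/
  minimal : ∀ i j l, MvPolynomial.constantCoeff (diff i (Pi.single j 1) l) = 0

/-- `J` is `d`-regular: `a i j ≤ d + i` for all `i` and `j`, where the `a i j` are the shifts in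
the minimal graded free resolution of `J` (which is unique up to isomorphism). -/
def IsRegular (J : Ideal (MvPolynomial (Fin n) k)) (d : ℤ) : Prop :=
  ∃ F : MinimalGradedFreeResolution J, ∀ i j, F.shift i j ≤ d + i

/-- `reg J = d`: the integer `d` is the least one such that `J` is `d`-regular. -/
def HasRegularity (J : Ideal (MvPolynomial (Fin n) k)) (d : ℤ) : Prop :=
  IsLeast {e : ℤ | IsRegular J e} d

end LexGin

/-!
The generic initial ideal of a finite set `X` of `s` points for the degree-lexicographic order is
computed in degrees at least `s`, and its regularity is read off from its generators.

*Shape in high degrees.* Choose coordinates in which no point lies on `x_r = 0` and the points have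
`s` distinct images under the projection to the coordinates `x_{r-1}, x_r`. The order eliminates
`x_0, …, x_{r-2}`, so a form whose leading monomial is `x_{r-1}^a x_r^b` with `a < s` is a binary
form, and it cannot vanish at `s` distinct points of the line
(`mem_tailExponents_of_mem_leadingExponents`). Conversely, by Lagrange interpolation every other
monomial of degree at least `s` agrees on `X` with a combination of such monomials, hence is a
leading monomial (`mem_leadingExponents_of_mem_tailExponents`). So in degrees at least `s` the
initial ideal is `(x_0, …, x_{r-2}, x_{r-1}^s)`. Consequently its generators have degree at most
`s`, and `x_{r-1}^s` is one of them.

*Generic coordinates.* The number of leading monomials in a final segment of the monomials of one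
degree is lower semicontinuous in the coordinates, being governed by minors
(`exists_leadingCount_le`). Hence it is maximal on a dense open set, and this determines the
initial ideal in the finitely many degrees below `s`. In characteristic zero the maximality also
forces strong stability (`IsGenericFor.move_mem`): if `u` is a leading exponent and its move
`u x_i / x_j` is not, the first-order effect of `x_j ↦ x_j + t x_i` on a form with leading
monomial `u` produces one more leading monomial.

*Regularity.* The minimal generators of a strongly stable ideal, ordered by increasing degree and
then lexicographically decreasing, have linear quotients, that is, the successive colon ideals are
generated by variables. The syzygies `X i • e_a - …` of such a family have linear quotients again,
with strictly fewer variables (`LinearQuotients.syzygies`). Iterating gives a resolution of finite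
length, whose `i`-th shifts are `i` plus degrees of generators, and which is minimal for degree
reasons (`LinearQuotients.isRegular`). So the regularity is at most the largest degree of a
generator; the reverse inequality is `degree_le_of_isRegular`.
-/

namespace LexGin

variable {k : Type*} [Field k] {n : ℕ}

/-! ### Forms of integer degree -/

theorem IsForm.zero (e : ℤ) : IsForm (0 : MvPolynomial (Fin n) k) e := by
  intro m hm; simp at hm

theorem isForm_iff_coeff {f : MvPolynomial (Fin n) k} {e : ℤ} :
    IsForm f e ↔ ∀ m, (m.degree : ℤ) ≠ e → f.coeff m = 0 := by
  constructor
  · intro h m hm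
    by_contra hc
    exact hm (h m (MvPolynomial.mem_support_iff.2 hc))
  · intro h m hm
    by_contra hc
    exact MvPolynomial.mem_support_iff.1 hm (h m hc)

theorem isForm_monomial (m : Fin n →₀ ℕ) (c : k) :
    IsForm (MvPolynomial.monomial m c) (m.degree : ℤ) := by
  classical
  intro a ha
  rw [MvPolynomial.support_monomial] at ha
  split_ifs at ha
  · simp at ha
  · simp at ha; rw [ha]

theorem isForm_X (i : Fin n) : IsForm (MvPolynomial.X i : MvPolynomial (Fin n) k) 1 := by
  have := isForm_monomial (k := k) (Finsupp.single i 1) 1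
  rwa [Finsupp.degree_single, Nat.cast_one] at this

theorem IsForm.mul {f g : MvPolynomial (Fin n) k} {d e : ℤ} (hf : IsForm f d) (hg : IsForm g e) :
    IsForm (f * g) (d + e) := by
  classical
  intro m hm
  obtain ⟨a, ha, b, hb, rfl⟩ := Finset.mem_add.1 (MvPolynomial.support_mul f g hm)
  rw [map_add, Nat.cast_add, hf a ha, hg b hb]

theorem IsForm.neg {f : MvPolynomial (Fin n) k} {d : ℤ} (hf : IsForm f d) : IsForm (-f) d := by
  intro m hm
  rw [MvPolynomial.support_neg] at hm
  exact hf m hm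

theorem IsForm.constantCoeff_eq_zero {f : MvPolynomial (Fin n) k} {d : ℤ} (hf : IsForm f d)
    (hd : 0 < d) : MvPolynomial.constantCoeff f = 0 := by
  rw [MvPolynomial.constantCoeff_eq]
  exact isForm_iff_coeff.1 hf 0 (by simpa using hd.ne)

/-- The component of `f` of integer degree `e`; it is zero for `e < 0`. -/
noncomputable def formComponent (e : ℤ) (f : MvPolynomial (Fin n) k) : MvPolynomial (Fin n) k :=
  if 0 ≤ e then MvPolynomial.homogeneousComponent e.toNat f else 0

theorem coeff_formComponent (e : ℤ) (f : MvPolynomial (Fin n) k) (m : Fin n →₀ ℕ) :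
    (formComponent e f).coeff m = if (m.degree : ℤ) = e then f.coeff m else 0 := by
  unfold formComponent
  split_ifs with h1 h2 h2
  · rw [MvPolynomial.coeff_homogeneousComponent, if_pos (by omega)]
  · rw [MvPolynomial.coeff_homogeneousComponent, if_neg (by omega)]
  · omega
  · exact MvPolynomial.coeff_zero _

theorem isForm_formComponent (e : ℤ) (f : MvPolynomial (Fin n) k) :
    IsForm (formComponent e f) e := by
  rw [isForm_iff_coeff]
  intro m hm
  rw [coeff_formComponent, if_neg hm]

theorem formComponent_zero (e : ℤ) : formComponent e (0 : MvPolynomial (Fin n) k) = 0 := by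
  ext m; simp [coeff_formComponent]

theorem formComponent_sum {ι : Type*} (e : ℤ) (s : Finset ι) (f : ι → MvPolynomial (Fin n) k) :
    formComponent e (∑ x ∈ s, f x) = ∑ x ∈ s, formComponent e (f x) := by
  ext m
  simp only [coeff_formComponent, MvPolynomial.coeff_sum]
  split_ifs <;> simp

theorem IsForm.formComponent_eq {f : MvPolynomial (Fin n) k} {e : ℤ} (hf : IsForm f e) :
    formComponent e f = f := by
  ext m
  rw [coeff_formComponent]
  split_ifs with h
  · rfl
  · exact (isForm_iff_coeff.1 hf m h).symm

theorem formComponent_mul {g : MvPolynomial (Fin n) k} {d : ℤ} (hg : IsForm g d) (e : ℤ)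
    (f : MvPolynomial (Fin n) k) :
    formComponent e (f * g) = formComponent (e - d) f * g := by
  classical
  ext m
  rw [coeff_formComponent, MvPolynomial.coeff_mul, MvPolynomial.coeff_mul]
  rw [← Finset.sum_filter_add_sum_filter_not (Finset.HasAntidiagonal.antidiagonal m)
    (fun x => (x.2.degree : ℤ) = d) (fun x => (formComponent (e - d) f).coeff x.1 * g.coeff x.2),
    Finset.sum_eq_zero
      (s := (Finset.HasAntidiagonal.antidiagonal m).filter (fun x => ¬ (x.2.degree : ℤ) = d)),
    ← Finset.sum_filter_add_sum_filter_not (Finset.HasAntidiagonal.antidiagonal m)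
    (fun x => (x.2.degree : ℤ) = d) (fun x => f.coeff x.1 * g.coeff x.2),
    Finset.sum_eq_zero
      (s := (Finset.HasAntidiagonal.antidiagonal m).filter (fun x => ¬ (x.2.degree : ℤ) = d)),
    add_zero, add_zero]
  · split_ifs with h
    · refine Finset.sum_congr rfl fun x hx => ?_
      simp only [Finset.mem_filter, Finset.HasAntidiagonal.mem_antidiagonal] at hx
      rw [coeff_formComponent, if_pos]
      rw [← h, ← hx.1, map_add, Nat.cast_add, hx.2]; ring
    · symm
      refine Finset.sum_eq_zero fun x hx => ?_
      simp only [Finset.mem_filter, Finset.HasAntidiagonal.mem_antidiagonal] at hx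
      rw [coeff_formComponent, if_neg, zero_mul]
      intro h'
      apply h
      rw [← hx.1, map_add, Nat.cast_add, hx.2, h']; ring
  · intro x hx
    rw [isForm_iff_coeff.1 hg _ (Finset.mem_filter.1 hx).2, mul_zero]
  · intro x hx
    rw [isForm_iff_coeff.1 hg _ (Finset.mem_filter.1 hx).2, mul_zero]

/-- In a graded free module, a homogeneous element of the span of homogeneous elements is a
combination of them with homogeneous coefficients of the expected degrees. -/
theorem exists_form_coeffs {ι κ : Type*} [Fintype κ] {d : ι → ℤ} {δ : κ → ℤ}
    {σ : κ → ι → MvPolynomial (Fin n) k} (hσ : ∀ y l, IsForm (σ y l) (δ y - d l))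
    (A : Set κ) {w : ι → MvPolynomial (Fin n) k} {e : ℤ} (hw : ∀ l, IsForm (w l) (e - d l))
    (hwA : w ∈ Submodule.span (MvPolynomial (Fin n) k) (σ '' A)) :
    ∃ c : κ → MvPolynomial (Fin n) k, (∀ y, y ∉ A → c y = 0) ∧ (∀ y, IsForm (c y) (e - δ y)) ∧
      w = ∑ y, c y • σ y := by
  classical
  obtain ⟨c, hc, rfl⟩ := (Finsupp.mem_span_image_iff_linearCombination _).1 hwA
  refine ⟨fun y => formComponent (e - δ y) (c y), ?_, fun y => isForm_formComponent _ _, ?_⟩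
  · intro y hy
    have : c y = 0 := by
      by_contra h
      exact hy (hc (Finsupp.mem_support_iff.2 h))
    simp only [this, formComponent_zero]
  · funext l
    have h1 := (hw l).formComponent_eq
    rw [← h1, Finsupp.linearCombination_apply, Finsupp.sum_fintype _ _ (by simp),
      Finset.sum_apply, Finset.sum_apply, formComponent_sum]
    refine Finset.sum_congr rfl fun y _ => ?_
    simp only [Pi.smul_apply, smul_eq_mul]
    rw [formComponent_mul (hσ y l)]
    congr 2
    ring

/-! ### Linear quotients -/

/-- The family `u`, indexed by a finite linear order, has linear quotients with degrees `d`: each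
colon ideal `(u b : b < a) : u a` is generated by the variables `X i` with `i ∈ W a`, and the
relation that puts `X i • u a` into the span of the earlier elements can be chosen
homogeneous, where `u b` has degree `d b`. The degrees are required to be nondecreasing. -/
structure LinearQuotients (k : Type*) [Field k] {n : ℕ} {κ M : Type*} [Fintype κ]
    [LinearOrder κ] [AddCommGroup M] [Module (MvPolynomial (Fin n) k) M] (d : κ → ℤ)
    (u : κ → M) (W : κ → Finset (Fin n)) : Prop where
  monotone : Monotone d
  colon_le : ∀ a (f : MvPolynomial (Fin n) k),
    f • u a ∈ Submodule.span (MvPolynomial (Fin n) k) (u '' Set.Iio a) →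
      f ∈ Ideal.span (MvPolynomial.X '' (W a : Set (Fin n)))
  relation : ∀ a, ∀ i ∈ W a, ∃ c : κ → MvPolynomial (Fin n) k, (∀ b, a ≤ b → c b = 0) ∧
    (∀ b, IsForm (c b) (d a + 1 - d b)) ∧
    (MvPolynomial.X i : MvPolynomial (Fin n) k) • u a = ∑ b, c b • u b

/-- Linear quotients are invariant under order isomorphisms of the index. -/
theorem LinearQuotients.comp_orderIso {κ κ' M : Type*} [Fintype κ] [LinearOrder κ] [Fintype κ']
    [LinearOrder κ'] [AddCommGroup M] [Module (MvPolynomial (Fin n) k) M] {d : κ → ℤ} {u : κ → M}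
    {W : κ → Finset (Fin n)} (h : LinearQuotients k d u W) (e : κ' ≃o κ) :
    LinearQuotients k (d ∘ e) (u ∘ e) (W ∘ e) where
  monotone := h.monotone.comp e.monotone
  colon_le a f hf := by
    refine h.colon_le (e a) f ?_
    rwa [Set.image_comp, e.image_Iio] at hf
  relation a i hi := by
    obtain ⟨c, h1, h2, h3⟩ := h.relation (e a) i hi
    refine ⟨c ∘ e, fun b hb => h1 _ (e.monotone hb), fun b => h2 _, ?_⟩
    rw [Function.comp_apply, h3]
    exact (Equiv.sum_comp e.toEquiv (fun b => c b • u b)).symm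

/-- A product `f * X i` lies in an ideal generated by variables other than `X i` only if `f`
does. -/
theorem mem_span_X_of_mul_X_mem {f : MvPolynomial (Fin n) k} {i : Fin n} {A : Set (Fin n)}
    (hi : i ∉ A) (h : f * MvPolynomial.X i ∈ Ideal.span (MvPolynomial.X '' A)) :
    f ∈ Ideal.span (MvPolynomial.X '' A) := by
  classical
  rw [MvPolynomial.mem_ideal_span_X_image] at h ⊢
  intro m hm
  obtain ⟨l, hl, hml⟩ := h (m + Finsupp.single i 1) (by
    rw [MvPolynomial.mem_support_iff, MvPolynomial.coeff_mul_X]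
    exact MvPolynomial.mem_support_iff.1 hm)
  refine ⟨l, hl, ?_⟩
  have : i ≠ l := fun h => hi (h ▸ hl)
  simpa [this] using hml

theorem exists_last_ne_zero {κ R : Type*} [Fintype κ] [LinearOrder κ] [Zero R] {z : κ → R}
    (hz : ¬ z = 0) : ∃ a, z a ≠ 0 ∧ ∀ b, a < b → z b = 0 := by
  classical
  have hne : (Finset.univ.filter fun b => z b ≠ 0).Nonempty := by
    obtain ⟨b, hb⟩ := Function.ne_iff.1 hz
    exact ⟨b, by simpa using hb⟩
  obtain ⟨a, ha, hmax⟩ := Finset.exists_max_image _ id hne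
  simp only [Finset.mem_filter, Finset.mem_univ, true_and, id] at ha hmax
  exact ⟨a, ha, fun b hb => by_contra fun hc => absurd (hmax b hc) (not_le.2 hb)⟩

section Syzygies

variable {κ M : Type*} [Fintype κ] [LinearOrder κ] [AddCommGroup M]
  [Module (MvPolynomial (Fin n) k) M] {d : κ → ℤ} {u : κ → M} {W : κ → Finset (Fin n)}

/-- The homogeneous syzygies with leading terms `X i • e_a`, for `i ∈ W a`. -/
theorem LinearQuotients.exists_syzygy (h : LinearQuotients k d u W) (x : Σₗ a, {i // i ∈ W a}) :
    ∃ s : κ → MvPolynomial (Fin n) k, ∑ b, s b • u b = 0 ∧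
      s (ofLex x).1 = MvPolynomial.X (ofLex x).2.1 ∧ (∀ b, (ofLex x).1 < b → s b = 0) ∧
      ∀ b, IsForm (s b) (d (ofLex x).1 + 1 - d b) := by
  classical
  obtain ⟨⟨a, i, hi⟩, rfl⟩ := toLex.surjective x
  obtain ⟨c, h1, h2, h3⟩ := h.relation a i hi
  refine ⟨Pi.single a (MvPolynomial.X i) - c, ?_, ?_, ?_, ?_⟩
  · simp only [Pi.sub_apply, sub_smul, Finset.sum_sub_distrib, ← h3]
    rw [Finset.sum_eq_single a]
    · simp
    · intro b _ hb; simp [hb]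
    · simp
  · simp [h1 a le_rfl]
  · intro b hb
    have hb : a < b := hb
    simp [h1 b hb.le, hb.ne']
  · intro b
    rcases eq_or_ne b a with rfl | hb
    · simpa [h1 b le_rfl] using isForm_X i
    · simpa [hb] using (h2 b).neg

/-- The syzygies of a family with linear quotients whose last nonzero entry is at `a` or before
are generated by the syzygies with leading terms `X i • e_b`, where `b ≤ a`. -/
theorem LinearQuotients.mem_span_syzygies (h : LinearQuotients k d u W)
    {σ : (Σₗ a, {i // i ∈ W a}) → κ → MvPolynomial (Fin n) k}
    (h0 : ∀ x, ∑ b, σ x b • u b = 0) (hX : ∀ x, σ x (ofLex x).1 = MvPolynomial.X (ofLex x).2.1)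
    (hlt : ∀ x b, (ofLex x).1 < b → σ x b = 0) (a : κ) :
    ∀ z : κ → MvPolynomial (Fin n) k, ∑ b, z b • u b = 0 → (∀ b, a < b → z b = 0) →
      z ∈ Submodule.span (MvPolynomial (Fin n) k) (σ '' {x | (ofLex x).1 ≤ a}) := by
  classical
  induction a using WellFoundedLT.induction with
  | ind a ih =>
  intro z hz hza
  have hmem : z a ∈ Ideal.span (MvPolynomial.X '' (W a : Set (Fin n))) := by
    refine h.colon_le a _ ?_
    rw [← Finset.add_sum_erase _ _ (Finset.mem_univ a), add_eq_zero_iff_eq_neg] at hz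
    rw [hz]
    refine Submodule.neg_mem _ (Submodule.sum_mem _ fun b hb => ?_)
    rcases lt_or_gt_of_ne (Finset.ne_of_mem_erase hb) with hb | hb
    · exact Submodule.smul_mem _ _ (Submodule.subset_span ⟨b, hb, rfl⟩)
    · rw [hza b hb, zero_smul]; exact Submodule.zero_mem _
  -- Clear the entry at `a`, then induct on the last nonzero entry of what remains.
  have key : ∃ w ∈ Submodule.span (MvPolynomial (Fin n) k) (σ '' {x | (ofLex x).1 ≤ a}),
      ∑ b, w b • u b = 0 ∧ (∀ b, a < b → w b = 0) ∧ w a = z a := by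
    refine Submodule.span_induction (p := fun (f : MvPolynomial (Fin n) k) _ =>
      ∃ w ∈ Submodule.span (MvPolynomial (Fin n) k) (σ '' {x | (ofLex x).1 ≤ a}),
      ∑ b, w b • u b = 0 ∧ (∀ b, a < b → w b = 0) ∧ w a = f) ?_ ?_ ?_ ?_ hmem
    · rintro _ ⟨i, hi, rfl⟩
      let x : Σₗ a, {i // i ∈ W a} := toLex ⟨a, i, hi⟩
      exact ⟨σ x, Submodule.subset_span ⟨x, le_rfl, rfl⟩, h0 x, hlt x, hX x⟩
    · exact ⟨0, Submodule.zero_mem _, by simp, by simp, rfl⟩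
    · rintro f g - - ⟨w, h1, h2, h3, rfl⟩ ⟨w', h1', h2', h3', rfl⟩
      refine ⟨w + w', Submodule.add_mem _ h1 h1', ?_, ?_, rfl⟩
      · simp [add_smul, Finset.sum_add_distrib, h2, h2']
      · intro b hb; simp [h3 b hb, h3' b hb]
    · rintro q f - ⟨w, h1, h2, h3, rfl⟩
      refine ⟨q • w, Submodule.smul_mem _ _ h1, ?_, ?_, rfl⟩
      · simp [mul_smul, ← Finset.smul_sum, h2]
      · intro b hb; simp [h3 b hb]
  obtain ⟨w, h1, h2, h3, h4⟩ := key
  rw [← sub_add_cancel z w]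
  refine Submodule.add_mem _ ?_ h1
  by_cases hzw : z - w = 0
  · rw [hzw]; exact Submodule.zero_mem _
  obtain ⟨a', ha', hmax⟩ := exists_last_ne_zero hzw
  have hlt' : a' < a := by
    by_contra hc
    rcases (not_lt.1 hc).eq_or_lt with rfl | hc
    · exact ha' (by simp [h4])
    · exact ha' (by simp [h3 _ hc, hza _ hc])
  have := ih a' hlt' (z - w) (by simp [sub_smul, Finset.sum_sub_distrib, hz, h2]) hmax
  refine Submodule.span_mono (Set.image_mono ?_) this
  exact fun x hx => le_trans hx hlt'.le

/-- The syzygies of a family with linear quotients again have linear quotients, with one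
variable fewer in each colon ideal. -/
theorem LinearQuotients.syzygies (h : LinearQuotients k d u W) :
    ∃ σ : (Σₗ a, {i // i ∈ W a}) → κ → MvPolynomial (Fin n) k,
      LinearQuotients k (fun x => d (ofLex x).1 + 1) σ
        (fun x => (W (ofLex x).1).filter (· < (ofLex x).2.1)) ∧
      (∀ x b, IsForm (σ x b) (d (ofLex x).1 + 1 - d b)) ∧
      (∀ x b, MvPolynomial.constantCoeff (σ x b) = 0) ∧
      ∀ z : κ → MvPolynomial (Fin n) k, ∑ b, z b • u b = 0 ↔
        z ∈ Submodule.span (MvPolynomial (Fin n) k) (Set.range σ) := by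
  classical
  choose σ h0 hX hlt hform using h.exists_syzygy
  have hcolon : ∀ a i i' (hi : i ∈ W a) (hi' : i' ∈ W a), i' < i →
      (MvPolynomial.X i' : MvPolynomial (Fin n) k) • σ (toLex ⟨a, i, hi⟩) ∈
        Submodule.span (MvPolynomial (Fin n) k) (σ '' Set.Iio (toLex ⟨a, i, hi⟩)) := by
    intro a i i' hi hi' hlt'
    set x : Σₗ a, {i // i ∈ W a} := toLex ⟨a, i, hi⟩
    set x' : Σₗ a, {i // i ∈ W a} := toLex ⟨a, i', hi'⟩
    have hxx' : x' < x := Sigma.Lex.right _ _ hlt'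
    set z : κ → MvPolynomial (Fin n) k :=
      (MvPolynomial.X i' : MvPolynomial (Fin n) k) • σ x -
        (MvPolynomial.X i : MvPolynomial (Fin n) k) • σ x' with hz
    have hx' : (MvPolynomial.X i : MvPolynomial (Fin n) k) • σ x' ∈
        Submodule.span (MvPolynomial (Fin n) k) (σ '' Set.Iio x) :=
      Submodule.smul_mem _ _ (Submodule.subset_span ⟨x', hxx', rfl⟩)
    have hzx : (MvPolynomial.X i' : MvPolynomial (Fin n) k) • σ x =
        z + (MvPolynomial.X i : MvPolynomial (Fin n) k) • σ x' := by rw [hz]; abel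
    rw [hzx]
    refine Submodule.add_mem _ ?_ hx'
    have hz0 : ∑ b, z b • u b = 0 := by
      simp only [hz, Pi.sub_apply, Pi.smul_apply, sub_smul, smul_assoc, Finset.sum_sub_distrib,
        ← Finset.smul_sum, h0, smul_zero, sub_zero]
    have hza : ∀ b, a ≤ b → z b = 0 := by
      intro b hb
      rcases hb.eq_or_lt with rfl | hb
      · have e1 : σ x a = MvPolynomial.X i := hX x
        have e2 : σ x' a = MvPolynomial.X i' := hX x'
        simp only [hz, Pi.sub_apply, Pi.smul_apply, e1, e2, smul_eq_mul]
        ring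
      · simp [hz, hlt x b hb, hlt x' b hb]
    by_cases hzz : z = 0
    · rw [hzz]; exact Submodule.zero_mem _
    obtain ⟨a', ha', hmax⟩ := exists_last_ne_zero hzz
    have hlt' : a' < a := by
      by_contra hc
      exact ha' (hza _ (not_lt.1 hc))
    refine Submodule.span_mono (Set.image_mono ?_)
      (h.mem_span_syzygies h0 hX hlt a' z hz0 hmax)
    intro y hy
    exact Sigma.Lex.left _ _ (lt_of_le_of_lt hy hlt')
  refine ⟨σ, ⟨?_, ?_, ?_⟩, hform, ?_, ?_⟩
  · intro x y hxy
    have : (ofLex x).1 ≤ (ofLex y).1 := by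
      rcases hxy with ⟨_, _, h⟩ | ⟨_, _, _⟩
      · exact h.le
      · exact le_rfl
    simpa using h.monotone this
  · rintro x f hf
    obtain ⟨⟨a, i, hi⟩, rfl⟩ := toLex.surjective x
    change f ∈ Ideal.span (MvPolynomial.X '' (((W a).filter (· < i) : Finset _) : Set (Fin n)))
    refine mem_span_X_of_mul_X_mem (i := i) (by simp) ?_
    have h1 := Submodule.mem_map_of_mem (f := LinearMap.proj (R := MvPolynomial (Fin n) k) a) hf
    have h2 : σ (toLex ⟨a, i, hi⟩) a = MvPolynomial.X i := hX (toLex ⟨a, i, hi⟩)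
    rw [map_smul, LinearMap.proj_apply, h2, smul_eq_mul, Submodule.map_span] at h1
    refine Submodule.span_le.2 ?_ h1
    rintro _ ⟨_, ⟨y, hy, rfl⟩, rfl⟩
    rw [LinearMap.proj_apply]
    rcases hy with ⟨i', _, hlt'⟩ | ⟨i', _, hlt'⟩
    · rename_i b
      have h3 : σ (toLex ⟨b, i'⟩) a = 0 := hlt _ _ hlt'
      exact h3 ▸ Submodule.zero_mem _
    · refine Submodule.subset_span ⟨i'.1, ?_, (hX (toLex ⟨a, i'⟩)).symm⟩
      have hlt'' : i'.1 < i := hlt'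
      simpa using hlt''
  · rintro x i' hi'
    obtain ⟨⟨a, i, hi⟩, rfl⟩ := toLex.surjective x
    have hi'' : i' ∈ W a ∧ i' < i := Finset.mem_filter.1 hi'
    obtain ⟨c, h1, h2, h3⟩ := exists_form_coeffs hform (Set.Iio (toLex ⟨a, i, hi⟩))
      (e := d a + 1 + 1) (fun l => by
        have h5 : IsForm (σ (toLex ⟨a, i, hi⟩) l) (d a + 1 - d l) := hform _ l
        have h6 := (isForm_X (k := k) i').mul h5
        rwa [show (1 : ℤ) + (d a + 1 - d l) = d a + 1 + 1 - d l by ring] at h6)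
      (hcolon a i i' hi hi''.1 hi''.2)
    exact ⟨c, fun y hy => h1 y (not_lt.2 hy), h2, h3⟩
  · intro x b
    rcases lt_or_ge (ofLex x).1 b with hb | hb
    · rw [hlt x b hb, map_zero]
    · refine (hform x b).constantCoeff_eq_zero ?_
      have := h.monotone hb
      omega
  · intro z
    constructor
    · intro hz
      by_cases hzz : z = 0
      · rw [hzz]; exact Submodule.zero_mem _
      obtain ⟨a', ha', hmax⟩ := exists_last_ne_zero hzz
      exact Submodule.span_mono (Set.image_subset_range _ _)
        (h.mem_span_syzygies h0 hX hlt a' z hz hmax)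
    · intro hz
      have : Submodule.span (MvPolynomial (Fin n) k) (Set.range σ) ≤
          LinearMap.ker (Fintype.linearCombination (MvPolynomial (Fin n) k) u) := by
        rw [Submodule.span_le]
        rintro _ ⟨x, rfl⟩
        exact h0 x
      exact this hz

/-- `LinearQuotients.syzygies` for families indexed by `Fin t`. -/
theorem LinearQuotients.exists_syzygies_fin {t : ℕ} {d : Fin t → ℤ} {u : Fin t → M}
    {W : Fin t → Finset (Fin n)} (h : LinearQuotients k d u W) :
    ∃ (t' : ℕ) (d' : Fin t' → ℤ) (u' : Fin t' → Fin t → MvPolynomial (Fin n) k)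
      (W' : Fin t' → Finset (Fin n)), LinearQuotients k d' u' W' ∧
      (∀ x b, IsForm (u' x b) (d' x - d b)) ∧
      (∀ x b, MvPolynomial.constantCoeff (u' x b) = 0) ∧
      (∀ z : Fin t → MvPolynomial (Fin n) k, ∑ b, z b • u b = 0 ↔
        z ∈ Submodule.span (MvPolynomial (Fin n) k) (Set.range u')) ∧
      ∀ x, ∃ a, d' x = d a + 1 ∧ (W' x).card + 1 ≤ (W a).card := by
  obtain ⟨σ, h1, h2, h3, h4⟩ := h.syzygies
  let e : Fin (Fintype.card (Σₗ a, {i // i ∈ W a})) ≃o (Σₗ a, {i // i ∈ W a}) :=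
    monoEquivOfFin _ rfl
  refine ⟨_, _, _, _, h1.comp_orderIso e, fun x b => h2 _ _, fun x b => h3 _ _, ?_, ?_⟩
  · intro z
    rw [h4, e.surjective.range_comp]
  · intro x
    refine ⟨(ofLex (e x)).1, rfl, ?_⟩
    refine Finset.card_lt_card (Finset.filter_ssubset.2 ⟨_, (ofLex (e x)).2.2, lt_irrefl _⟩)

end Syzygies

/-! ### The minimal resolution of an ideal with linear quotients -/

/-- A homogeneous family `u` of vectors in a graded free module of rank `m` (with basis in
degrees `δ`), with linear quotients and with all entries in the irrelevant maximal ideal: one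
differential of the resolution. -/
structure SyzygyFamily (k : Type*) [Field k] (n : ℕ) where
  /-- the rank of the ambient free module -/
  m : ℕ
  /-- the number of elements of the family -/
  t : ℕ
  /-- the degrees of the basis of the ambient free module -/
  δ : Fin m → ℤ
  /-- the degrees of the elements of the family -/
  d : Fin t → ℤ
  /-- the elements of the family -/
  u : Fin t → Fin m → MvPolynomial (Fin n) k
  /-- the variables in the colon ideals -/
  W : Fin t → Finset (Fin n)
  linearQuotients : LinearQuotients k d u W
  isForm : ∀ x b, IsForm (u x b) (d x - δ b)
  minimal : ∀ x b, MvPolynomial.constantCoeff (u x b) = 0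

/-- The syzygies of a family with linear quotients, as a family with linear quotients. -/
noncomputable def LinearQuotients.syzygyFamily {M : Type*} [AddCommGroup M]
    [Module (MvPolynomial (Fin n) k) M] {t : ℕ} {d : Fin t → ℤ} {u : Fin t → M}
    {W : Fin t → Finset (Fin n)} (h : LinearQuotients k d u W) : SyzygyFamily k n where
  m := t
  t := h.exists_syzygies_fin.choose
  δ := d
  d := h.exists_syzygies_fin.choose_spec.choose
  u := h.exists_syzygies_fin.choose_spec.choose_spec.choose
  W := h.exists_syzygies_fin.choose_spec.choose_spec.choose_spec.choose
  linearQuotients := h.exists_syzygies_fin.choose_spec.choose_spec.choose_spec.choose_spec.1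
  isForm := h.exists_syzygies_fin.choose_spec.choose_spec.choose_spec.choose_spec.2.1
  minimal := h.exists_syzygies_fin.choose_spec.choose_spec.choose_spec.choose_spec.2.2.1

section

variable {M : Type*} [AddCommGroup M] [Module (MvPolynomial (Fin n) k) M] {t : ℕ} {d : Fin t → ℤ}
  {u : Fin t → M} {W : Fin t → Finset (Fin n)}

theorem LinearQuotients.sum_smul_eq_zero_iff (h : LinearQuotients k d u W)
    (z : Fin t → MvPolynomial (Fin n) k) : ∑ b, z b • u b = 0 ↔
      z ∈ Submodule.span (MvPolynomial (Fin n) k) (Set.range h.syzygyFamily.u) :=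
  h.exists_syzygies_fin.choose_spec.choose_spec.choose_spec.choose_spec.2.2.2.1 z

theorem LinearQuotients.exists_syzygyFamily_d_eq (h : LinearQuotients k d u W)
    (x : Fin h.syzygyFamily.t) :
    ∃ a, h.syzygyFamily.d x = d a + 1 ∧ (h.syzygyFamily.W x).card + 1 ≤ (W a).card :=
  h.exists_syzygies_fin.choose_spec.choose_spec.choose_spec.choose_spec.2.2.2.2 x

/-- The iterated syzygy families. -/
noncomputable def LinearQuotients.iterSyzygy (h : LinearQuotients k d u W) :
    ℕ → SyzygyFamily k n
  | 0 => h.syzygyFamily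
  | i + 1 => (h.iterSyzygy i).linearQuotients.syzygyFamily

theorem LinearQuotients.iterSyzygy_bound (h : LinearQuotients k d u W) {e : ℤ}
    (he : ∀ a, d a ≤ e) (i : ℕ) (x : Fin (h.iterSyzygy i).t) :
    (h.iterSyzygy i).d x ≤ e + (i + 1) ∧ ((h.iterSyzygy i).W x).card + (i + 1) ≤ n := by
  induction i with
  | zero =>
    obtain ⟨a, h1, h2⟩ := h.exists_syzygyFamily_d_eq x
    have h3 := Finset.card_le_univ (W a)
    rw [Fintype.card_fin] at h3
    have h4 := he a
    constructor
    · change h.syzygyFamily.d x ≤ _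
      rw [h1]; simpa using h4
    · exact h2.trans h3
  | succ i ih =>
    obtain ⟨a, h1, h2⟩ := (h.iterSyzygy i).linearQuotients.exists_syzygyFamily_d_eq x
    obtain ⟨h3, h4⟩ := ih a
    constructor
    · change (h.iterSyzygy i).linearQuotients.syzygyFamily.d x ≤ _
      rw [h1]; push_cast; linarith
    · change ((h.iterSyzygy i).linearQuotients.syzygyFamily.W x).card + _ ≤ _
      omega

end

/-- An ideal generated by forms of degree at most `e` with linear quotients is `e`-regular:
iterated syzygies give its minimal resolution, with `i`-th shifts of the form `d a + i`. -/
theorem LinearQuotients.isRegular {J : Ideal (MvPolynomial (Fin n) k)} {t : ℕ} {d : Fin t → ℤ}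
    {u : Fin t → MvPolynomial (Fin n) k} {W : Fin t → Finset (Fin n)}
    (h : LinearQuotients k d u W) (hu : ∀ a, IsForm (u a) (d a))
    (hJ : Ideal.span (Set.range u) = J) {e : ℤ} (he : ∀ a, d a ≤ e) : IsRegular J e := by
  classical
  have exact_of : ∀ {t m : ℕ} {N : Type _} [AddCommGroup N] [Module (MvPolynomial (Fin n) k) N]
      (v : Fin t → Fin m → MvPolynomial (Fin n) k) (w : Fin m → N)
      (_ : ∀ z : Fin m → MvPolynomial (Fin n) k, ∑ b, z b • w b = 0 ↔
        z ∈ Submodule.span (MvPolynomial (Fin n) k) (Set.range v)),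
      Function.Exact (Fintype.linearCombination (MvPolynomial (Fin n) k) v)
        (Fintype.linearCombination (MvPolynomial (Fin n) k) w) := by
    intro t m N _ _ v w hvw z
    rw [Fintype.linearCombination_apply, hvw, ← Fintype.range_linearCombination]
    rfl
  have single : ∀ {t : ℕ} {N : Type _} [AddCommGroup N] [Module (MvPolynomial (Fin n) k) N]
      (v : Fin t → N) (j : Fin t),
      Fintype.linearCombination (MvPolynomial (Fin n) k) v (Pi.single j 1) = v j := by
    intro t N _ _ v j
    rw [Fintype.linearCombination_apply_single, one_smul]
  refine ⟨{
    rank := fun i => (h.iterSyzygy i).m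
    length := n
    rank_eq_zero := ?_
    shift := fun i => (h.iterSyzygy i).δ
    aug := Fintype.linearCombination (MvPolynomial (Fin n) k) u
    diff := fun i => Fintype.linearCombination (MvPolynomial (Fin n) k) (h.iterSyzygy i).u
    aug_isForm := ?_
    diff_isForm := ?_
    range_aug := ?_
    exact_zero := ?_
    exact_succ := ?_
    minimal := ?_ }, ?_⟩
  · intro i hi
    obtain ⟨i, rfl⟩ : ∃ i', i = i' + 1 := ⟨i - 1, by omega⟩
    change (h.iterSyzygy i).t = 0
    by_contra hc
    have := (h.iterSyzygy_bound he i ⟨0, Nat.pos_of_ne_zero hc⟩).2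
    omega
  · exact fun j => (congrArg (IsForm · (d j)) (single u j)).mpr (hu j)
  · exact fun i j l => (congrArg (fun f => IsForm (f l) _) (single (h.iterSyzygy i).u j)).mpr
      ((h.iterSyzygy i).isForm j l)
  · rw [← hJ]
    exact Fintype.range_linearCombination _ _
  · exact exact_of _ _ h.sum_smul_eq_zero_iff
  · exact fun i => exact_of _ _ (h.iterSyzygy i).linearQuotients.sum_smul_eq_zero_iff
  · exact fun i j l => (congrArg (fun f => MvPolynomial.constantCoeff (f l))
      (single (h.iterSyzygy i).u j)).trans ((h.iterSyzygy i).minimal j l)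
  · rintro (_ | i) j
    · have := he j
      rw [Nat.cast_zero, add_zero]
      exact this
    · have := (h.iterSyzygy_bound he i j).1
      rw [Nat.cast_succ]
      exact this


/-! ### Strongly stable monomial ideals -/

/-- A set of exponents is strongly stable if it is closed under replacing a variable by a smaller
indexed (that is, larger) one. -/
def StronglyStable (L : Set (Fin n →₀ ℕ)) : Prop :=
  ∀ m ∈ L, ∀ i j, i < j → m j ≠ 0 → m - Finsupp.single j 1 + Finsupp.single i 1 ∈ L

theorem degree_move {m : Fin n →₀ ℕ} {j : Fin n} (hj : m j ≠ 0) (i : Fin n) :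
    (m - Finsupp.single j 1 + Finsupp.single i 1).degree = m.degree := by
  have h : m - Finsupp.single j 1 + Finsupp.single j 1 = m :=
    tsub_add_cancel_of_le (Finsupp.single_le_iff.2 (Nat.one_le_iff_ne_zero.2 hj))
  conv_rhs => rw [← h]
  simp [map_add, Finsupp.degree_single]

theorem eq_of_le_of_degree_eq {v u : Fin n →₀ ℕ} (h : v ≤ u) (hd : v.degree = u.degree) :
    v = u := by
  have h1 := tsub_add_cancel_of_le h
  have h2 : (u - v).degree = 0 := by
    have := congrArg Finsupp.degree h1
    rw [map_add] at this
    omega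
  rw [Finsupp.degree_eq_zero_iff] at h2
  rw [h2, zero_add] at h1
  exact h1

theorem degree_le_of_le {v u : Fin n →₀ ℕ} (h : v ≤ u) : v.degree ≤ u.degree := by
  rw [← tsub_add_cancel_of_le h, map_add]; omega

/-- Moving exponents to smaller indices turns `v` into a divisor of `u` if `v` exceeds `u` only
beyond the support of `u`. -/
theorem StronglyStable.exists_le {L : Set (Fin n →₀ ℕ)} (hL : StronglyStable L)
    {u : Fin n →₀ ℕ} (N : ℕ) : ∀ v ∈ L, ∑ i, (v i - u i) = N → v.degree ≤ u.degree →
      (∀ j, u j < v j → ∀ i, u i ≠ 0 → i ≤ j) → ∃ v' ∈ L, v' ≤ u ∧ v'.degree = v.degree := by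
  induction N with
  | zero =>
    intro v hv hN _ _
    refine ⟨v, hv, fun i => ?_, rfl⟩
    have := (Finset.sum_eq_zero_iff.1 hN) i (Finset.mem_univ i)
    omega
  | succ N ih =>
    intro v hv hN hdeg hsupp
    obtain ⟨j, -, hj⟩ := Finset.exists_ne_zero_of_sum_ne_zero (hN.trans_ne N.succ_ne_zero)
    replace hj : u j < v j := by omega
    obtain ⟨i, hi⟩ : ∃ i, v i < u i := by
      by_contra! hc
      have := eq_of_le_of_degree_eq (v := u) (u := v) hc (le_antisymm (degree_le_of_le hc) hdeg)
      rw [this] at hj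
      exact lt_irrefl _ hj
    have hij : i < j := lt_of_le_of_ne (hsupp j hj i (by omega)) (by rintro rfl; omega)
    set w := v - Finsupp.single j 1 + Finsupp.single i 1 with hw
    have hwi : w i = v i + 1 := by simp [hw, hij.ne]
    have hwj : w j = v j - 1 := by simp [hw, hij.ne]
    have hwl : ∀ l, l ≠ i → l ≠ j → w l = v l := by
      intro l h1 h2; simp [hw, h1, h2]
    have hwdeg : w.degree = v.degree := degree_move (by omega) i
    obtain ⟨v', h1, h2, h3⟩ := ih w (hL v hv i j hij (by omega)) (by
      have e1 : ∑ l, (w l - u l) + 1 = ∑ l, (v l - u l) := by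
        rw [← Finset.add_sum_erase _ _ (Finset.mem_univ j),
          ← Finset.add_sum_erase _ (fun l => v l - u l) (Finset.mem_univ j)]
        have : ∑ l ∈ Finset.univ.erase j, (w l - u l) = ∑ l ∈ Finset.univ.erase j, (v l - u l) := by
          refine Finset.sum_congr rfl fun l hl => ?_
          rcases eq_or_ne l i with rfl | hli
          · omega
          · rw [hwl l hli (Finset.ne_of_mem_erase hl)]
        omega
      omega) (hwdeg.trans_le hdeg) (by
      intro l hl
      refine hsupp l ?_
      rcases eq_or_ne l i with rfl | hli
      · omega
      rcases eq_or_ne l j with rfl | hlj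
      · omega
      rwa [hwl l hli hlj] at hl)
    exact ⟨v', h1, h2, h3.trans hwdeg⟩

/-- The order of the minimal generators that gives linear quotients: by increasing degree, and
lexicographically decreasing within one degree. -/
noncomputable def generatorKey (m : Fin n →₀ ℕ) : ℕ ×ₗ (Lex (Fin n →₀ ℕ))ᵒᵈ :=
  toLex (m.degree, OrderDual.toDual (toLex m))

theorem generatorKey_injective : Function.Injective (generatorKey (n := n)) := by
  intro a b h
  have := congrArg (fun x => (ofLex x).2) h
  exact this

theorem generatorKey_lt_iff {v u : Fin n →₀ ℕ} : generatorKey v < generatorKey u ↔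
    v.degree < u.degree ∨ v.degree = u.degree ∧ toLex u < toLex v := by
  unfold generatorKey
  rw [Prod.Lex.toLex_lt_toLex]
  rfl

theorem toLex_lt_move {u : Fin n →₀ ℕ} {i j : Fin n} (hij : i < j) :
    toLex u < toLex (u - Finsupp.single j 1 + Finsupp.single i 1) := by
  rw [Finsupp.Lex.lt_iff]
  refine ⟨i, fun l hl => ?_, ?_⟩
  · simp [hl.ne, (hl.trans hij).ne]
  · simp [hij.ne]

theorem StronglyStable.exists_ne_zero {L : Set (Fin n →₀ ℕ)} (hL : StronglyStable L)
    {u v m : Fin n →₀ ℕ} (hu : Minimal (· ∈ L) u) (hv : Minimal (· ∈ L) v)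
    (hvu : generatorKey v < generatorKey u) (hle : v ≤ m + u) :
    ∃ i, (∃ j, i < j ∧ u j ≠ 0) ∧ m i ≠ 0 := by
  by_contra! hc
  have hdeg : v.degree ≤ u.degree := by
    rcases generatorKey_lt_iff.1 hvu with h | h
    · exact h.le
    · exact h.1.le
  obtain ⟨v', h1, h2, h3⟩ := hL.exists_le (u := u) _ v hv.prop rfl hdeg (by
    intro j hj i hi
    by_contra! hji
    have := hle j
    rw [Finsupp.add_apply, hc j ⟨i, hji, hi⟩] at this
    omega)
  have h4 : v' = u := hu.eq_of_le h1 h2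
  rw [h4] at h3
  rcases generatorKey_lt_iff.1 hvu with h | ⟨-, h⟩
  · omega
  rw [Finsupp.Lex.lt_iff] at h
  obtain ⟨j, hj1, hj2⟩ := h
  simp only [ofLex_toLex] at hj1 hj2
  have huv : u ≤ v := by
    intro l
    rcases lt_trichotomy l j with hl | rfl | hl
    · exact (hj1 l hl).le
    · exact hj2.le
    · by_contra! hl'
      have hul : u l ≠ 0 := by omega
      have := hle j
      rw [Finsupp.add_apply, hc j ⟨l, hl, hul⟩] at this
      omega
  rw [hv.eq_of_le hu.prop huv] at hj2
  exact lt_irrefl _ hj2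

theorem exists_minimal_le {L : Set (Fin n →₀ ℕ)} {m : Fin n →₀ ℕ} (hm : m ∈ L) :
    ∃ v ≤ m, Minimal (· ∈ L) v := exists_minimal_le_of_wellFoundedLT _ m hm

theorem StronglyStable.exists_minimal_lt {L : Set (Fin n →₀ ℕ)} (hL : StronglyStable L)
    {u : Fin n →₀ ℕ} (hu : u ∈ L) {i j : Fin n} (hij : i < j) (hj : u j ≠ 0) :
    ∃ v, Minimal (· ∈ L) v ∧ generatorKey v < generatorKey u ∧ v ≤ u + Finsupp.single i 1 := by
  obtain ⟨v, hv1, hv2⟩ := exists_minimal_le (hL u hu i j hij hj)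
  refine ⟨v, hv2, ?_, hv1.trans (by gcongr; exact tsub_le_self)⟩
  rw [generatorKey_lt_iff]
  have h1 := degree_le_of_le hv1
  rw [degree_move hj] at h1
  rcases h1.lt_or_eq with h1 | h1
  · exact Or.inl h1
  · refine Or.inr ⟨h1, ?_⟩
    rw [eq_of_le_of_degree_eq hv1 (by rw [h1, degree_move hj])]
    exact toLex_lt_move hij

/-- The exponents of the minimal generators of the monomial ideal with exponents `L`. -/
@[ext]
structure MinimalExponent (L : Set (Fin n →₀ ℕ)) where
  /-- the exponent -/
  val : Fin n →₀ ℕ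
  minimal : Minimal (· ∈ L) val

noncomputable instance (L : Set (Fin n →₀ ℕ)) : LinearOrder (MinimalExponent L) :=
  LinearOrder.lift' (fun m => generatorKey m.val)
    (fun _ _ h => MinimalExponent.ext (generatorKey_injective h))

/-- A strongly stable monomial ideal that is generated in degrees at most `s` is `s`-regular: its
minimal generators have linear quotients. -/
theorem StronglyStable.isRegular {L : Set (Fin n →₀ ℕ)} (hL : StronglyStable L) {s : ℕ}
    (hs : ∀ m, Minimal (· ∈ L) m → m.degree ≤ s) :
    IsRegular (Ideal.span ((fun m => MvPolynomial.monomial m (1 : k)) '' L)) s := by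
  classical
  have hfin : {m : Fin n →₀ ℕ | Minimal (· ∈ L) m}.Finite :=
    (Finsupp.finite_of_degree_le (σ := Fin n) s).subset fun m hm => hs m hm
  let κ := MinimalExponent L
  have : Finite {m : Fin n →₀ ℕ // Minimal (· ∈ L) m} := hfin
  have : Finite κ := Finite.of_injective
    (fun a : κ => (⟨a.val, a.minimal⟩ : {m : Fin n →₀ ℕ // Minimal (· ∈ L) m}))
    (fun a b h => MinimalExponent.ext (congrArg Subtype.val h))
  have : Fintype κ := Fintype.ofFinite κ
  have hlt : ∀ a b : κ, a < b ↔ generatorKey a.val < generatorKey b.1 := fun a b => Iff.rfl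
  have hle : ∀ a b : κ, a ≤ b ↔ generatorKey a.val ≤ generatorKey b.1 := fun a b => Iff.rfl
  have h : LinearQuotients k (fun m : κ => (m.val.degree : ℤ))
      (fun m : κ => MvPolynomial.monomial m.val (1 : k))
      (fun m : κ => Finset.univ.filter fun i => ∃ j, i < j ∧ m.val j ≠ 0) := by
    refine ⟨?_, ?_, ?_⟩
    · intro a b hab
      rcases hab.lt_or_eq with hab | rfl
      · rcases generatorKey_lt_iff.1 ((hlt a b).1 hab) with h | h
        · exact Int.ofNat_le.2 h.le
        · exact Int.ofNat_le.2 h.1.le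
      · exact le_rfl
    · intro a f hf
      rw [MvPolynomial.mem_ideal_span_X_image]
      intro m hm
      have himg : (fun m : κ => MvPolynomial.monomial m.val (1 : k)) '' Set.Iio a =
          (fun m => MvPolynomial.monomial m (1 : k)) '' (MinimalExponent.val '' Set.Iio a) := by
        rw [Set.image_image]
      rw [himg, smul_eq_mul] at hf
      obtain ⟨_, ⟨v, hv, rfl⟩, hvm⟩ :=
          MvPolynomial.mem_ideal_span_monomial_image.1 hf (m + a.val) (by
        rw [MvPolynomial.mem_support_iff, MvPolynomial.coeff_mul_monomial, mul_one]
        exact MvPolynomial.mem_support_iff.1 hm)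
      obtain ⟨i, h1, h2⟩ := hL.exists_ne_zero a.minimal v.minimal ((hlt v a).1 hv) hvm
      exact ⟨i, by simpa using h1, h2⟩
    · intro a i hi
      obtain ⟨j, hij, hj⟩ : ∃ j, i < j ∧ a.val j ≠ 0 := by simpa using hi
      obtain ⟨v, h1, h2, h3⟩ := hL.exists_minimal_lt a.minimal.prop hij hj
      refine ⟨Pi.single ⟨v, h1⟩ (MvPolynomial.monomial (a.val + Finsupp.single i 1 - v) 1),
        ?_, ?_, ?_⟩
      · intro b hb
        refine Pi.single_eq_of_ne (M := fun _ => MvPolynomial (Fin n) k) ?_ _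
        rintro rfl
        exact absurd h2 (not_lt.2 ((hle _ _).1 hb))
      · intro b
        rcases eq_or_ne b ⟨v, h1⟩ with rfl | hb
        · rw [Pi.single_eq_same]
          have h4 := isForm_monomial (k := k) (a.val + Finsupp.single i 1 - v) 1
          have h5 := congrArg Finsupp.degree (tsub_add_cancel_of_le h3)
          rw [map_add, map_add, Finsupp.degree_single] at h5
          convert h4 using 1
          simp only
          omega
        · rw [Pi.single_eq_of_ne (M := fun _ => MvPolynomial (Fin n) k) hb]
          exact IsForm.zero _
      · rw [Finset.sum_eq_single ⟨v, h1⟩]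
        · rw [Pi.single_eq_same, smul_eq_mul, smul_eq_mul, MvPolynomial.X,
            MvPolynomial.monomial_mul, MvPolynomial.monomial_mul, tsub_add_cancel_of_le h3,
            add_comm]
        · intro b _ hb
          rw [Pi.single_eq_of_ne (M := fun _ => MvPolynomial (Fin n) k) hb, zero_smul]
        · simp
  let e : Fin (Fintype.card κ) ≃o κ := monoEquivOfFin κ rfl
  refine (h.comp_orderIso e).isRegular (fun a => isForm_monomial _ _) ?_
    (fun a => Int.ofNat_le.2 (hs _ (e a).minimal))
  rw [e.surjective.range_comp]
  refine le_antisymm (Ideal.span_mono ?_) (Ideal.span_le.2 ?_)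
  · rintro _ ⟨m, rfl⟩
    exact ⟨m.val, m.minimal.prop, rfl⟩
  · rintro _ ⟨m, hm, rfl⟩
    obtain ⟨v, hv, hv'⟩ := exists_minimal_le hm
    have := Ideal.mul_mem_left (Ideal.span (Set.range fun m : κ =>
      MvPolynomial.monomial m.val (1 : k))) (MvPolynomial.monomial (m - v) 1)
      (Ideal.subset_span ⟨⟨v, hv'⟩, rfl⟩)
    simp only [MvPolynomial.monomial_mul, tsub_add_cancel_of_le hv, mul_one] at this
    exact this


/-! ### Leading exponents of homogeneous ideals -/

/-- The exponents of the leading monomials of the nonzero elements of `V`. -/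
def leadingExponents (V : Ideal (MvPolynomial (Fin n) k)) : Set (Fin n →₀ ℕ) :=
  {m | ∃ f ∈ V, f ≠ 0 ∧ MonomialOrder.degLex.degree f = m}

theorem initialIdeal_eq_span (V : Ideal (MvPolynomial (Fin n) k)) :
    initialIdeal MonomialOrder.degLex V =
      Ideal.span ((fun m => MvPolynomial.monomial m (1 : k)) '' leadingExponents V) := by
  refine le_antisymm (Ideal.span_le.2 ?_) (Ideal.span_le.2 ?_)
  · rintro _ ⟨f, hf, rfl⟩
    by_cases h0 : f = 0
    · simp [h0, MonomialOrder.leadingTerm]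
    · rw [← MonomialOrder.C_mul_leadingCoeff_monomial_degree]
      exact Ideal.mul_mem_left _ _ (Ideal.subset_span ⟨_, ⟨f, hf, h0, rfl⟩, rfl⟩)
  · rintro _ ⟨_, ⟨f, hf, h0, rfl⟩, rfl⟩
    have h1 := Ideal.mul_mem_left (initialIdeal MonomialOrder.degLex V)
      (MvPolynomial.C (MonomialOrder.degLex.leadingCoeff f)⁻¹)
      (Ideal.subset_span ⟨f, hf, rfl⟩)
    rwa [← MonomialOrder.C_mul_leadingCoeff_monomial_degree, ← mul_assoc, ← MvPolynomial.C_mul,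
      inv_mul_cancel₀ (MonomialOrder.leadingCoeff_ne_zero_iff.2 h0), MvPolynomial.C_1,
      one_mul] at h1

theorem isUpperSet_leadingExponents (V : Ideal (MvPolynomial (Fin n) k)) :
    IsUpperSet (leadingExponents V) := by
  classical
  rintro m m' hmm' ⟨f, hf, h0, rfl⟩
  have h1 : MvPolynomial.monomial (m' - MonomialOrder.degLex.degree f) (1 : k) ≠ 0 := by
    simp
  refine ⟨MvPolynomial.monomial (m' - MonomialOrder.degLex.degree f) 1 * f,
    Ideal.mul_mem_left _ _ hf, mul_ne_zero h1 h0, ?_⟩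
  rw [MonomialOrder.degree_mul h1 h0, MonomialOrder.degree_monomial, if_neg one_ne_zero]
  exact tsub_add_cancel_of_le hmm'

/-- An ideal is homogeneous if it is generated by forms. -/
def IsHomogeneousIdeal (V : Ideal (MvPolynomial (Fin n) k)) : Prop :=
  ∃ S : Set (MvPolynomial (Fin n) k), (∀ f ∈ S, ∃ d : ℕ, f.IsHomogeneous d) ∧ Ideal.span S = V

theorem IsHomogeneousIdeal.homogeneousComponent_mem {V : Ideal (MvPolynomial (Fin n) k)}
    (hV : IsHomogeneousIdeal V) {f : MvPolynomial (Fin n) k} (hf : f ∈ V) (d : ℕ) :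
    MvPolynomial.homogeneousComponent d f ∈ V := by
  obtain ⟨S, hS, rfl⟩ := hV
  let := MvPolynomial.gradedAlgebra (σ := Fin n) (R := k)
  exact MvPolynomial.homogeneousComponent_mem_of_mem
    (Ideal.homogeneous_span (MvPolynomial.homogeneousSubmodule (Fin n) k) S hS) hf d

/-- The leading exponents of a homogeneous ideal are those of its forms. -/
theorem mem_leadingExponents_iff {V : Ideal (MvPolynomial (Fin n) k)}
    (hV : IsHomogeneousIdeal V) {m : Fin n →₀ ℕ} :
    m ∈ leadingExponents V ↔ ∃ f ∈ V, f.IsHomogeneous m.degree ∧ f.coeff m = 1 ∧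
      ∀ m', toLex m < toLex m' → f.coeff m' = 0 := by
  constructor
  · rintro ⟨f, hf, h0, rfl⟩
    set m := MonomialOrder.degLex.degree f with hm
    have hc : f.coeff m ≠ 0 := MonomialOrder.leadingCoeff_ne_zero_iff.2 h0
    refine ⟨MvPolynomial.C (f.coeff m)⁻¹ * MvPolynomial.homogeneousComponent m.degree f,
      Ideal.mul_mem_left _ _ (hV.homogeneousComponent_mem hf _),
      (MvPolynomial.homogeneousComponent_isHomogeneous _ _).C_mul _, ?_, ?_⟩
    · rw [MvPolynomial.coeff_C_mul, MvPolynomial.coeff_homogeneousComponent, if_pos rfl,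
        inv_mul_cancel₀ hc]
    · intro m' hlt
      rw [MvPolynomial.coeff_C_mul, MvPolynomial.coeff_homogeneousComponent]
      split_ifs with hd
      · rw [MonomialOrder.coeff_eq_zero_of_lt (m := MonomialOrder.degLex) (f := f) (d := m'),
          mul_zero]
        rw [MonomialOrder.degLex_lt_iff, Finsupp.DegLex.lt_iff]
        exact Or.inr ⟨hd.symm, hlt⟩
      · rw [mul_zero]
  · rintro ⟨f, hf, hhom, h1, hlt⟩
    have h0 : f ≠ 0 := by
      rintro rfl; simp at h1
    refine ⟨f, hf, h0, ?_⟩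
    have h2 : m ∈ f.support := by rw [MvPolynomial.mem_support_iff, h1]; exact one_ne_zero
    have h3 := MonomialOrder.degLex.le_degree h2
    have h4 : f.coeff (MonomialOrder.degLex.degree f) ≠ 0 :=
      MonomialOrder.leadingCoeff_ne_zero_iff.2 h0
    rw [MonomialOrder.degLex_le_iff, Finsupp.DegLex.le_iff] at h3
    rcases h3 with h3 | ⟨-, h3⟩
    · exact absurd (hhom.coeff_eq_zero (ne_of_gt h3)) h4
    · rcases h3.lt_or_eq with h3 | h3
      · exact absurd (hlt _ h3) h4
      · exact (toLex.injective h3).symm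

/-! ### Linear changes of coordinates -/

theorem changeCoords_X (g : GL (Fin n) k) (j : Fin n) :
    changeCoords g (MvPolynomial.X j) = ∑ i, MvPolynomial.C (g i j) * MvPolynomial.X i := by
  rw [changeCoords, MvPolynomial.aeval_X]

theorem eval_changeCoords (g : GL (Fin n) k) (v : Fin n → k) (f : MvPolynomial (Fin n) k) :
    MvPolynomial.eval v (changeCoords g f) =
      MvPolynomial.eval ((g : Matrix (Fin n) (Fin n) k).transpose.mulVec v) f := by
  induction f using MvPolynomial.induction_on with
  | C a => simp
  | add p q hp hq => simp only [map_add, hp, hq]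
  | mul_X p j hp =>
    simp only [map_mul, hp, changeCoords_X, map_sum, MvPolynomial.eval_C, MvPolynomial.eval_X,
      Matrix.mulVec, dotProduct, Matrix.transpose_apply]

theorem changeCoords_mul_apply (g h : GL (Fin n) k) (f : MvPolynomial (Fin n) k) :
    changeCoords (g * h) f = changeCoords g (changeCoords h f) := by
  have : changeCoords (g * h) = (changeCoords g).comp (changeCoords h) := by
    refine MvPolynomial.algHom_ext fun j => ?_
    simp only [AlgHom.comp_apply, changeCoords_X, map_sum, map_mul, MvPolynomial.algHom_C,
      MvPolynomial.algebraMap_eq, Finset.mul_sum, Units.val_mul, Matrix.mul_apply, Finset.sum_mul]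
    rw [Finset.sum_comm]
    refine Finset.sum_congr rfl fun i _ => Finset.sum_congr rfl fun l _ => ?_
    ring
  rw [this, AlgHom.comp_apply]

theorem changeCoords_one_apply (f : MvPolynomial (Fin n) k) : changeCoords 1 f = f := by
  have : changeCoords (1 : GL (Fin n) k) = AlgHom.id k _ := by
    refine MvPolynomial.algHom_ext fun j => ?_
    rw [changeCoords_X, Finset.sum_eq_single j]
    · simp
    · intro i _ hij; simp [Matrix.one_apply_ne hij]
    · simp
  rw [this, AlgHom.id_apply]

theorem changeCoords_isHomogeneous (g : GL (Fin n) k) {f : MvPolynomial (Fin n) k} {d : ℕ}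
    (hf : f.IsHomogeneous d) : (changeCoords g f).IsHomogeneous d := by
  have := hf.aeval (fun j => ∑ i, MvPolynomial.C (g i j) * MvPolynomial.X i) (n := 1)
    fun j => MvPolynomial.IsHomogeneous.sum _ _ _ fun i _ => MvPolynomial.isHomogeneous_C_mul_X _ _
  rwa [one_mul] at this

theorem mem_transform_iff (g : GL (Fin n) k) (I : Ideal (MvPolynomial (Fin n) k))
    (f : MvPolynomial (Fin n) k) : f ∈ transform g I ↔ changeCoords g⁻¹ f ∈ I := by
  have hsurj : Function.Surjective (changeCoords g) := fun f =>
    ⟨changeCoords g⁻¹ f, by rw [← changeCoords_mul_apply, mul_inv_cancel, changeCoords_one_apply]⟩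
  rw [transform, Ideal.mem_map_iff_of_surjective _ hsurj]
  constructor
  · rintro ⟨h, hh, rfl⟩
    rwa [← changeCoords_mul_apply, inv_mul_cancel, changeCoords_one_apply]
  · intro h
    exact ⟨_, h, by rw [← changeCoords_mul_apply, mul_inv_cancel, changeCoords_one_apply]⟩

theorem changeCoords_mem_transform_mul (b g : GL (Fin n) k) {I : Ideal (MvPolynomial (Fin n) k)}
    {f : MvPolynomial (Fin n) k} (hf : f ∈ transform g I) :
    changeCoords b f ∈ transform (b * g) I := by
  rw [mem_transform_iff] at hf ⊢
  rwa [← changeCoords_mul_apply, mul_inv_rev, inv_mul_cancel_right]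

theorem transform_isHomogeneous (g : GL (Fin n) k) {I : Ideal (MvPolynomial (Fin n) k)}
    (hI : IsHomogeneousIdeal I) : IsHomogeneousIdeal (transform g I) := by
  obtain ⟨S, hS, rfl⟩ := hI
  refine ⟨changeCoords g '' S, ?_, (Ideal.map_span _ _).symm⟩
  rintro _ ⟨x, hx, rfl⟩
  obtain ⟨d, hd⟩ := hS x hx
  exact ⟨d, changeCoords_isHomogeneous g hd⟩


/-! ### Leading exponents of points in general coordinates -/

/-- Exponents divisible by a variable before `X p`, or by `X p ^ s`. For `s` points in general
coordinates, with `p` the index before the last, these are the leading exponents of the ideal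
in degrees at least `s`. -/
def tailExponents (p : Fin n) (s : ℕ) : Set (Fin n →₀ ℕ) :=
  {m | (∃ i < p, m i ≠ 0) ∨ s ≤ m p}

theorem not_mem_tailExponents_iff {p : Fin n} {s : ℕ} {m : Fin n →₀ ℕ} :
    m ∉ tailExponents p s ↔ (∀ i < p, m i = 0) ∧ m p < s := by
  simp [tailExponents]

theorem not_mem_tailExponents_of_le {p : Fin n} {s : ℕ} {m m' : Fin n →₀ ℕ}
    (hm : m ∉ tailExponents p s) (hle : toLex m' ≤ toLex m) : m' ∉ tailExponents p s := by
  rcases hle.lt_or_eq with h | h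
  · rw [not_mem_tailExponents_iff] at hm ⊢
    obtain ⟨l, h1, h2⟩ := Finsupp.Lex.lt_iff.1 h
    simp only [ofLex_toLex] at h1 h2
    have hl : p ≤ l := by
      by_contra! hc
      have := hm.1 l hc
      omega
    refine ⟨fun i hi => (h1 i (hi.trans_le hl)).trans (hm.1 i hi), ?_⟩
    rcases hl.lt_or_eq with hl | rfl
    · rw [h1 p hl]; exact hm.2
    · exact h2.trans hm.2
  · rwa [toLex.injective h]

theorem degree_eq_add {p q : Fin n} (hpq : p < q) (hq : ∀ i, i ≠ q → i ≤ p)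
    {m : Fin n →₀ ℕ} (hm : ∀ i < p, m i = 0) : m.degree = m p + m q := by
  rw [Finsupp.degree_eq_sum, Fintype.sum_eq_add p q hpq.ne]
  rintro x ⟨h1, h2⟩
  exact hm x (lt_of_le_of_ne (hq x h2) h1)

theorem eq_of_not_mem_tailExponents {p q : Fin n} (hpq : p < q) (hq : ∀ i, i ≠ q → i ≤ p)
    {s : ℕ} {m m' : Fin n →₀ ℕ} (hm : m ∉ tailExponents p s)
    (hm' : m' ∉ tailExponents p s) (hd : m.degree = m'.degree) (hp : m p = m' p) : m = m' := by
  rw [not_mem_tailExponents_iff] at hm hm'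
  rw [degree_eq_add hpq hq hm.1, degree_eq_add hpq hq hm'.1] at hd
  ext i
  rcases eq_or_ne i q with rfl | hi
  · omega
  rcases (hq i hi).lt_or_eq with hi | rfl
  · rw [hm.1 i hi, hm'.1 i hi]
  · exact hp

theorem prod_pow_eq {p q : Fin n} (hpq : p < q) (hq : ∀ i, i ≠ q → i ≤ p)
    {s : ℕ} {m : Fin n →₀ ℕ} (hm : m ∉ tailExponents p s) {y : Fin n → k}
    (hy : y q = 1) : ∏ i, y i ^ m i = y p ^ m p := by
  rw [not_mem_tailExponents_iff] at hm
  refine Fintype.prod_eq_single p fun x hx => ?_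
  rcases eq_or_ne x q with rfl | hi
  · rw [hy, one_pow]
  · rw [hm.1 x (lt_of_le_of_ne (hq x hi) hx), pow_zero]

theorem tailExponents_stronglyStable {p q : Fin n} (hpq : p < q) (hq : ∀ i, i ≠ q → i ≤ p)
    (s : ℕ) : StronglyStable (tailExponents p s) := by
  intro m hm i j hij hj
  have hip : i ≤ p := by
    refine hq i ?_
    rintro rfl
    exact absurd (hq j hij.ne') (not_le.2 (hpq.trans hij))
  rcases hip.lt_or_eq with hi | rfl
  · exact Or.inl ⟨i, hi, by simp⟩
  · rcases hm with ⟨l, hl, hml⟩ | hm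
    · refine Or.inl ⟨l, hl, ?_⟩
      simpa [hl.ne, (hl.trans hij).ne] using hml
    · refine Or.inr ?_
      simp [hij.ne]
      omega

/-- A generator of the monomial ideal of `tailExponents` has degree at most `s`. -/
theorem exists_sub_single_mem_tailExponents {p q : Fin n} (hpq : p < q) (hq : ∀ i, i ≠ q → i ≤ p)
    {s : ℕ} {m : Fin n →₀ ℕ}
    (hm : m ∈ tailExponents p s) (hs : s < m.degree) :
    ∃ l, m l ≠ 0 ∧ m - Finsupp.single l 1 ∈ tailExponents p s := by
  have hne : ∀ m : Fin n →₀ ℕ, m.degree ≠ 0 → ∃ l, m l ≠ 0 := by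
    intro m hm
    by_contra! hc
    exact hm ((Finsupp.degree_eq_zero_iff m).2 (Finsupp.ext hc))
  rcases Nat.eq_zero_or_pos s with rfl | hs0
  · obtain ⟨l, hl⟩ := hne m (by omega)
    exact ⟨l, hl, Or.inr (Nat.zero_le _)⟩
  rcases em (∃ i < p, m i ≠ 0) with ⟨i, hi, hmi⟩ | hm'
  · have h1 : m - Finsupp.single i 1 + Finsupp.single i 1 = m :=
      tsub_add_cancel_of_le (Finsupp.single_le_iff.2 (Nat.one_le_iff_ne_zero.2 hmi))
    have h2 := congrArg Finsupp.degree h1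
    rw [map_add, Finsupp.degree_single] at h2
    obtain ⟨l, hl⟩ := hne (m - Finsupp.single i 1) (by omega)
    refine ⟨l, ?_, Or.inl ⟨i, hi, ?_⟩⟩
    · rw [Finsupp.tsub_apply] at hl; omega
    · rcases eq_or_ne i l with rfl | hil
      · simpa using hl
      · simpa [hil] using hmi
  · have hsp : s ≤ m p := hm.resolve_left hm'
    push Not at hm'
    rcases Nat.eq_zero_or_pos (m q) with h0 | h0
    · have := degree_eq_add hpq hq hm'
      refine ⟨p, by omega, Or.inr ?_⟩
      simp
      omega
    · refine ⟨q, by omega, Or.inr ?_⟩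
      simpa [hpq.ne] using hsp

/-- By elimination, a form with leading exponent outside `tailExponents` only involves the last
two variables and has degree less than `s` in the first of them. It cannot vanish at `s` points
with distinct projections to the projective line. -/
theorem mem_tailExponents_of_mem_leadingExponents {p q : Fin n} (hpq : p < q)
    (hq : ∀ i, i ≠ q → i ≤ p) {ι : Type*} [Fintype ι] {y : ι → Fin n → k}
    (hyq : ∀ a, y a q = 1)
    (hyp : Function.Injective fun a => y a p) {V : Ideal (MvPolynomial (Fin n) k)}
    (hmem : ∀ (f : MvPolynomial (Fin n) k) (d : ℕ), f.IsHomogeneous d →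
      (f ∈ V ↔ ∀ a, MvPolynomial.eval (y a) f = 0)) (hV : IsHomogeneousIdeal V) {m : Fin n →₀ ℕ}
    (hm : m ∈ leadingExponents V) : m ∈ tailExponents p (Fintype.card ι) := by
  classical
  by_contra hmB
  obtain ⟨f, hf, hhom, h1, hlt⟩ := (mem_leadingExponents_iff hV).1 hm
  have hsupp : ∀ m' ∈ f.support, m' ∉ tailExponents p (Fintype.card ι) := by
    intro m' hm'
    refine not_mem_tailExponents_of_le hmB (not_lt.1 fun h => ?_)
    exact MvPolynomial.mem_support_iff.1 hm' (hlt m' h)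
  let P : Polynomial k := ∑ m' ∈ f.support, Polynomial.monomial (m' p) (f.coeff m')
  have hP : P = 0 := by
    refine Polynomial.eq_zero_of_degree_lt_of_eval_index_eq_zero (s := Finset.univ)
      (v := fun a => y a p) hyp.injOn ?_ ?_
    · refine (Polynomial.degree_sum_le _ _).trans_lt ?_
      rw [Finset.sup_lt_iff (WithBot.bot_lt_coe _)]
      intro m' hm'
      refine (Polynomial.degree_monomial_le _ _).trans_lt ?_
      exact_mod_cast (not_mem_tailExponents_iff.1 (hsupp m' hm')).2
    · intro a _
      rw [← (hmem f _ hhom).1 hf a, MvPolynomial.eval_eq', Polynomial.eval_finsetSum]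
      refine Finset.sum_congr rfl fun m' hm' => ?_
      rw [Polynomial.eval_monomial, prod_pow_eq hpq hq (hsupp m' hm') (hyq a)]
  have h2 := congrArg (Polynomial.coeff · (m p)) hP
  simp only [P, Polynomial.finsetSum_coeff, Polynomial.coeff_monomial, Polynomial.coeff_zero] at h2
  have hms : m ∈ f.support := by
    rw [MvPolynomial.mem_support_iff, h1]; exact one_ne_zero
  rw [Finset.sum_eq_single_of_mem m hms, if_pos rfl, h1] at h2
  · exact one_ne_zero h2
  · intro m' hm' hne
    rw [if_neg]
    intro hp
    refine hne (eq_of_not_mem_tailExponents hpq hq (hsupp m' hm') hmB ?_ hp)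
    by_contra hd
    exact MvPolynomial.mem_support_iff.1 hm' (hhom.coeff_eq_zero hd)

/-- By Lagrange interpolation, every monomial of degree at least `s` agrees at the points with a
form in the last two variables of degree less than `s` in the first of them. -/
theorem mem_leadingExponents_of_mem_tailExponents {p q : Fin n} (hpq : p < q)
    (hq : ∀ i, i ≠ q → i ≤ p) {ι : Type*} [Fintype ι] {y : ι → Fin n → k}
    (hyq : ∀ a, y a q = 1)
    (hyp : Function.Injective fun a => y a p) {V : Ideal (MvPolynomial (Fin n) k)}
    (hmem : ∀ (f : MvPolynomial (Fin n) k) (d : ℕ), f.IsHomogeneous d →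
      (f ∈ V ↔ ∀ a, MvPolynomial.eval (y a) f = 0)) (hV : IsHomogeneousIdeal V) {m : Fin n →₀ ℕ}
    (hm : m ∈ tailExponents p (Fintype.card ι)) (hd : Fintype.card ι ≤ m.degree) :
    m ∈ leadingExponents V := by
  classical
  set s := Fintype.card ι
  let P : Polynomial k := Lagrange.interpolate Finset.univ (fun a => y a p)
    (fun a => MvPolynomial.eval (y a) (MvPolynomial.monomial m 1))
  let e : ℕ → Fin n →₀ ℕ := fun a => Finsupp.single p a + Finsupp.single q (m.degree - a)
  have hep : ∀ a, e a p = a := by intro a; simp [e, hpq.ne]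
  have heB : ∀ a < s, e a ∉ tailExponents p s := by
    intro a ha
    rw [not_mem_tailExponents_iff, hep]
    refine ⟨fun i hi => ?_, ha⟩
    simp [e, hi.ne, (hi.trans hpq).ne]
  have hed : ∀ a < s, (e a).degree = m.degree := by
    intro a ha
    simp only [e, map_add, Finsupp.degree_single]
    omega
  let Q : MvPolynomial (Fin n) k := ∑ a ∈ Finset.range s, MvPolynomial.monomial (e a) (P.coeff a)
  have hQ : ∀ m', Q.coeff m' ≠ 0 → m' ∉ tailExponents p s := by
    intro m' h
    rw [MvPolynomial.coeff_sum] at h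
    obtain ⟨a, ha, h⟩ := Finset.exists_ne_zero_of_sum_ne_zero h
    rw [MvPolynomial.coeff_monomial] at h
    have : e a = m' := by
      by_contra hc
      exact h (if_neg hc)
    rw [← this]
    exact heB a (Finset.mem_range.1 ha)
  have hhom : (MvPolynomial.monomial m 1 - Q).IsHomogeneous m.degree := by
    refine (MvPolynomial.isHomogeneous_monomial _ rfl).sub
      (MvPolynomial.IsHomogeneous.sum _ _ _ fun a ha => ?_)
    exact MvPolynomial.isHomogeneous_monomial _ (hed a (Finset.mem_range.1 ha))
  refine (mem_leadingExponents_iff hV).2 ⟨MvPolynomial.monomial m 1 - Q, ?_, hhom, ?_, ?_⟩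
  · rw [hmem _ _ hhom]
    intro b
    have hs : 0 < s := Fintype.card_pos_iff.2 ⟨b⟩
    have hdeg : P.natDegree < s := by
      by_cases hP : P = 0
      · rw [hP, Polynomial.natDegree_zero]; exact hs
      · rw [Polynomial.natDegree_lt_iff_degree_lt hP]
        exact Lagrange.degree_interpolate_lt _ hyp.injOn
    have h1 : P.eval (y b p) = MvPolynomial.eval (y b) (MvPolynomial.monomial m 1) :=
      Lagrange.eval_interpolate_at_node _ hyp.injOn (Finset.mem_univ b)
    rw [map_sub, sub_eq_zero, ← h1, Polynomial.eval_eq_sum_range' hdeg, map_sum]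
    refine Finset.sum_congr rfl fun a ha => ?_
    rw [MvPolynomial.eval_monomial, Finsupp.prod_fintype _ _ (by simp),
      prod_pow_eq hpq hq (heB a (Finset.mem_range.1 ha)) (hyq b), hep]
  · rw [MvPolynomial.coeff_sub, MvPolynomial.coeff_monomial, if_pos rfl]
    rw [sub_eq_self]
    by_contra hc
    exact hQ m hc hm
  · intro m' hlt
    have hne : m ≠ m' := by rintro rfl; exact lt_irrefl _ hlt
    rw [MvPolynomial.coeff_sub, MvPolynomial.coeff_monomial, if_neg hne, zero_sub, neg_eq_zero]
    by_contra hc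
    exact not_mem_tailExponents_of_le (hQ m' hc) hlt.le hm


/-! ### Counting leading exponents -/

/-- The determinant of a matrix that is triangular for an injective key on its index set. -/
theorem det_eq_prod_of_key {ι α R : Type*} [Fintype ι] [DecidableEq ι] [LinearOrder α] [CommRing R]
    (key : ι → α) (hkey : Function.Injective key) (M : Matrix ι ι R)
    (h : ∀ x y, key y < key x → M x y = 0) : M.det = ∏ x, M x x := by
  let : LinearOrder ι := LinearOrder.lift' key hkey
  have := Matrix.det_of_isUpperTriangular (M := M) (fun x y hxy => h x y hxy)
  convert this

/-- The number of leading exponents of `V` in the finite set `A`. -/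
noncomputable def leadingCount (V : Ideal (MvPolynomial (Fin n) k)) (A : Finset (Fin n →₀ ℕ)) : ℕ :=
  open Classical in (A.filter (· ∈ leadingExponents V)).card

theorem leadingCount_eq (V : Ideal (MvPolynomial (Fin n) k)) (A : Finset (Fin n →₀ ℕ))
    [DecidablePred (· ∈ leadingExponents V)] :
    leadingCount V A = (A.filter (· ∈ leadingExponents V)).card := by
  unfold leadingCount
  congr

/-- `A` consists of exponents of degree `d` and is closed under passing to lexicographically larger
exponents of degree `d`. -/
structure IsFinalSegment (A : Finset (Fin n →₀ ℕ)) (d : ℕ) : Prop where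
  degree_eq : ∀ m ∈ A, m.degree = d
  mem_of_le : ∀ m ∈ A, ∀ m' : Fin n →₀ ℕ, m'.degree = d → toLex m ≤ toLex m' → m' ∈ A

/-- Forms in `V` with a nonzero minor of coefficients at exponents in a final segment `A` force
as many leading exponents in `A`: a combination of the forms that vanishes at the leading
exponents in `A` must vanish on all of `A`. -/
theorem card_le_leadingCount {V : Ideal (MvPolynomial (Fin n) k)} {A : Finset (Fin n →₀ ℕ)} {d : ℕ}
    (hA : IsFinalSegment A d) {ι : Type*} [Fintype ι] [DecidableEq ι]
    {h : ι → MvPolynomial (Fin n) k} (hV : ∀ y, h y ∈ V) (hd : ∀ y, (h y).IsHomogeneous d)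
    {a : ι → Fin n →₀ ℕ} (ha : ∀ x, a x ∈ A)
    (hdet : (Matrix.of fun x y => (h y).coeff (a x)).det ≠ 0) :
    Fintype.card ι ≤ leadingCount V A := by
  classical
  by_contra! hlt
  rw [leadingCount_eq] at hlt
  set T := A.filter (· ∈ leadingExponents V) with hT
  let φ : (ι → k) →ₗ[k] (T → k) :=
    LinearMap.pi fun t => Fintype.linearCombination k fun y => (h y).coeff t.1
  have hker : LinearMap.ker φ ≠ ⊥ := LinearMap.ker_ne_bot_of_finrank_lt (by
    rw [Module.finrank_pi, Module.finrank_pi, Fintype.card_coe]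
    exact hlt)
  obtain ⟨c, hc, hc0⟩ := Submodule.exists_mem_ne_zero_of_ne_bot hker
  let f : MvPolynomial (Fin n) k := ∑ y, MvPolynomial.C (c y) * h y
  have hcoeff : ∀ m, f.coeff m = ∑ y, c y * (h y).coeff m := by
    intro m
    simp [f, MvPolynomial.coeff_sum, MvPolynomial.coeff_C_mul]
  have hfT : ∀ t ∈ T, f.coeff t = 0 := by
    intro t ht
    rw [hcoeff]
    exact congrFun (LinearMap.mem_ker.1 hc) ⟨t, ht⟩
  have hfd : f.IsHomogeneous d := MvPolynomial.IsHomogeneous.sum _ _ _ fun y _ => (hd y).C_mul _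
  have hfV : f ∈ V := V.sum_mem fun y _ => V.mul_mem_left _ (hV y)
  obtain ⟨x, hx⟩ : ∃ x, f.coeff (a x) ≠ 0 := by
    by_contra! hcon
    refine hc0 (Matrix.eq_zero_of_mulVec_eq_zero hdet (funext fun x => ?_))
    have := hcon x
    rw [hcoeff] at this
    simp only [Matrix.mulVec, dotProduct, Matrix.of_apply, Pi.zero_apply]
    simpa [mul_comm] using this
  have hf0 : f ≠ 0 := by
    rintro h0; rw [h0] at hx; simp at hx
  have hlead : f.coeff (MonomialOrder.degLex.degree f) ≠ 0 :=
    MonomialOrder.leadingCoeff_ne_zero_iff.2 hf0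
  have hdeg : ∀ m, f.coeff m ≠ 0 → m.degree = d := by
    intro m hm
    by_contra hne
    exact hm (hfd.coeff_eq_zero hne)
  have hle := MonomialOrder.degLex.le_degree (MvPolynomial.mem_support_iff.2 hx)
  rw [MonomialOrder.degLex_le_iff, Finsupp.DegLex.le_iff] at hle
  refine hlead (hfT _ (Finset.mem_filter.2 ⟨?_, ⟨f, hfV, hf0, rfl⟩⟩))
  refine hA.mem_of_le _ (ha x) _ (hdeg _ hlead) ?_
  rcases hle with hle | hle
  · have h1 := hdeg _ hlead
    have h2 := hdeg _ hx
    simp only [ofDegLex_toDegLex] at hle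
    omega
  · exact hle.2

/-! ### Generic coordinates -/

/-- The change of coordinates `x_j ↦ ∑ i, G i j • x_i` for a matrix `G` over a `k`-algebra. -/
noncomputable def coordsOver {R : Type*} [CommRing R] [Algebra k R] (G : Matrix (Fin n) (Fin n) R) :
    MvPolynomial (Fin n) k →ₐ[k] MvPolynomial (Fin n) R :=
  MvPolynomial.aeval fun j => ∑ i, MvPolynomial.C (G i j) * MvPolynomial.X i

theorem coordsOver_coe (g : GL (Fin n) k) :
    coordsOver (k := k) (g : Matrix (Fin n) (Fin n) k) = changeCoords g := rfl

theorem map_coordsOver {R R' : Type*} [CommRing R] [Algebra k R] [CommRing R'] [Algebra k R']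
    (ψ : R →ₐ[k] R') (G : Matrix (Fin n) (Fin n) R) (f : MvPolynomial (Fin n) k) :
    MvPolynomial.map (ψ : R →+* R') (coordsOver G f) = coordsOver (G.map ψ) f := by
  have : (MvPolynomial.mapAlgHom ψ).comp (coordsOver (k := k) G) = coordsOver (G.map ψ) := by
    refine MvPolynomial.algHom_ext fun j => ?_
    simp [coordsOver]
  exact DFunLike.congr_fun this f

theorem coeff_coordsOver {R R' : Type*} [CommRing R] [Algebra k R] [CommRing R'] [Algebra k R']
    (ψ : R →ₐ[k] R') (G : Matrix (Fin n) (Fin n) R) (f : MvPolynomial (Fin n) k)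
    (m : Fin n →₀ ℕ) : ψ ((coordsOver G f).coeff m) = (coordsOver (G.map ψ) f).coeff m := by
  rw [← map_coordsOver, MvPolynomial.coeff_map]
  rfl

/-- Evaluation of polynomials in the matrix entries at an invertible matrix. -/
noncomputable abbrev evalGL (g : GL (Fin n) k) (p : MvPolynomial (Fin n × Fin n) k) : k :=
  MvPolynomial.eval (fun ij : Fin n × Fin n => g ij.1 ij.2) p

/-- Forms in `V` with prescribed leading exponents of degree `d` and leading coefficient one. -/
theorem exists_forms {V : Ideal (MvPolynomial (Fin n) k)} (hV : IsHomogeneousIdeal V)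
    (T : Finset (Fin n →₀ ℕ)) {d : ℕ} (hd : ∀ t ∈ T, t.degree = d)
    (hT : ∀ t ∈ T, t ∈ leadingExponents V) :
    ∃ f : T → MvPolynomial (Fin n) k, (∀ t, f t ∈ V) ∧ (∀ t, (f t).IsHomogeneous d) ∧
      (∀ t, (f t).coeff t = 1) ∧ ∀ t m, toLex t.1 < toLex m → (f t).coeff m = 0 := by
  choose f h1 h2 h3 h4 using fun t : T => (mem_leadingExponents_iff hV).1 (hT t.1 t.2)
  exact ⟨f, h1, fun t => hd t.1 t.2 ▸ h2 t, h3, h4⟩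

/-- Lower semicontinuity of the number of leading exponents in a final segment. -/
theorem exists_leadingCount_le {I : Ideal (MvPolynomial (Fin n) k)} (hI : IsHomogeneousIdeal I)
    {A : Finset (Fin n →₀ ℕ)} {d : ℕ} (hA : IsFinalSegment A d) (g₀ : GL (Fin n) k) :
    ∃ p : MvPolynomial (Fin n × Fin n) k, evalGL g₀ p ≠ 0 ∧ ∀ g, evalGL g p ≠ 0 →
      leadingCount (transform g₀ I) A ≤ leadingCount (transform g I) A := by
  classical
  set T := A.filter (· ∈ leadingExponents (transform g₀ I)) with hT
  obtain ⟨f, h1, h2, h3, h4⟩ := exists_forms (transform_isHomogeneous g₀ hI) T (d := d)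
    (fun t ht => hA.degree_eq t (Finset.mem_filter.1 ht).1) (fun t ht => (Finset.mem_filter.1 ht).2)
  let F : T → MvPolynomial (Fin n) k := fun t => changeCoords g₀⁻¹ (f t)
  have hF : ∀ t, changeCoords g₀ (F t) = f t := fun t => by
    rw [← changeCoords_mul_apply, mul_inv_cancel, changeCoords_one_apply]
  let p : MvPolynomial (Fin n × Fin n) k :=
    (Matrix.of fun t t' : T => (coordsOver (Matrix.mvPolynomialX (Fin n) (Fin n) k)
      (F t')).coeff t.1).det
  have hp : ∀ g, evalGL g p =
      (Matrix.of fun t t' : T => (changeCoords g (F t')).coeff t.1).det := by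
    intro g
    let ψ : MvPolynomial (Fin n × Fin n) k →ₐ[k] k :=
      MvPolynomial.aeval fun ij : Fin n × Fin n => g ij.1 ij.2
    have e1 : evalGL g p = ψ p := by
      simp [ψ, evalGL, MvPolynomial.aeval_eq_eval]
    rw [e1, AlgHom.map_det]
    congr 1
    ext t t'
    have e2 : (Matrix.mvPolynomialX (Fin n) (Fin n) k).map ψ = (g : Matrix (Fin n) (Fin n) k) := by
      ext i j; simp [ψ]
    rw [AlgHom.mapMatrix_apply, Matrix.map_apply, Matrix.of_apply, Matrix.of_apply,
      coeff_coordsOver, e2, coordsOver_coe]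
  refine ⟨p, ?_, fun g hg => ?_⟩
  · rw [hp, det_eq_prod_of_key (fun t : T => toLex t.1)
      (toLex.injective.comp Subtype.val_injective)]
    · refine Finset.prod_ne_zero_iff.2 fun t _ => ?_
      rw [Matrix.of_apply, hF, h3]; exact one_ne_zero
    · intro t t' hlt
      rw [Matrix.of_apply, hF, h4 _ _ hlt]
  · rw [hp] at hg
    have := card_le_leadingCount (V := transform g I) hA (h := fun t => changeCoords g (F t))
      (fun t => Ideal.mem_map_of_mem _ ((mem_transform_iff _ _ _).1 (h1 t)))
      (fun t => changeCoords_isHomogeneous _ (changeCoords_isHomogeneous _ (h2 t)))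
      (a := fun t => t.1) (fun t => (Finset.mem_filter.1 t.2).1) hg
    rw [Fintype.card_coe] at this
    rwa [leadingCount_eq]

/-- The coordinates `g` maximize the number of leading exponents of `g · I` in `A`. -/
def IsGenericFor (I : Ideal (MvPolynomial (Fin n) k)) (A : Finset (Fin n →₀ ℕ))
    (g : GL (Fin n) k) : Prop :=
  ∀ g', leadingCount (transform g' I) A ≤ leadingCount (transform g I) A

/-- The coordinates generic for `A` contain a nonempty principal open set: the maximal count is
attained, and it stays attained where the minor of `exists_leadingCount_le` does not vanish. -/
theorem exists_isGenericFor {I : Ideal (MvPolynomial (Fin n) k)} (hI : IsHomogeneousIdeal I)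
    {A : Finset (Fin n →₀ ℕ)} {d : ℕ} (hA : IsFinalSegment A d) :
    ∃ p : MvPolynomial (Fin n × Fin n) k, p ≠ 0 ∧ ∀ g, evalGL g p ≠ 0 → IsGenericFor I A g := by
  classical
  have hfin : (Set.range fun g : GL (Fin n) k => leadingCount (transform g I) A).Finite :=
    (Set.finite_le_nat A.card).subset (by
      rintro _ ⟨g, rfl⟩
      exact Finset.card_filter_le _ _)
  obtain ⟨_, ⟨g₀, rfl⟩, hmax⟩ := Set.exists_max_image _ id hfin ⟨_, 1, rfl⟩
  obtain ⟨p, h1, h2⟩ := exists_leadingCount_le hI hA g₀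
  refine ⟨p, ?_, fun g hg g' => (hmax _ ⟨g', rfl⟩).trans (h2 g hg)⟩
  rintro rfl
  exact h1 (map_zero _)

/-! ### Strong stability in generic coordinates -/

/-- First order expansion of the substitution `x_j ↦ x_j + t x_i`. -/
theorem exists_coordsOver_transvection (i j : Fin n) (f : MvPolynomial (Fin n) k) :
    ∃ R : MvPolynomial (Fin n) (Polynomial k),
      coordsOver (Matrix.transvection i j (Polynomial.X : Polynomial k)) f =
        MvPolynomial.map Polynomial.C f + MvPolynomial.C Polynomial.X *
          MvPolynomial.map Polynomial.C (MvPolynomial.X i * MvPolynomial.pderiv j f) +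
        MvPolynomial.C (Polynomial.X ^ 2) * R := by
  classical
  induction f using MvPolynomial.induction_on with
  | C a => exact ⟨0, by simp [coordsOver, MvPolynomial.algebraMap_apply]⟩
  | add p q hp hq =>
    obtain ⟨R, hR⟩ := hp
    obtain ⟨R', hR'⟩ := hq
    refine ⟨R + R', ?_⟩
    rw [map_add, hR, hR']
    simp only [map_add, mul_add]
    ring
  | mul_X p l hp =>
    obtain ⟨R, hR⟩ := hp
    have hX : coordsOver (Matrix.transvection i j (Polynomial.X : Polynomial k))
        (MvPolynomial.X l : MvPolynomial (Fin n) k) = MvPolynomial.X l +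
          if l = j then MvPolynomial.C Polynomial.X * MvPolynomial.X i else 0 := by
      rw [coordsOver, MvPolynomial.aeval_X]
      simp only [Matrix.transvection, Matrix.add_apply, map_add, add_mul, Finset.sum_add_distrib]
      congr 1
      · rw [Finset.sum_eq_single l]
        · simp
        · intro i _ hij; simp [Matrix.one_apply_ne hij]
        · simp
      · split_ifs with h
        · subst h
          rw [Finset.sum_eq_single i]
          · simp
          · intro i' _ hij; simp [hij.symm]
          · simp
        · refine Finset.sum_eq_zero fun i' _ => ?_
          simp [Ne.symm h]
    by_cases h : l = j
    · subst h
      refine ⟨R * MvPolynomial.X l + MvPolynomial.map Polynomial.C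
        (MvPolynomial.X i * MvPolynomial.pderiv l p) * MvPolynomial.X i +
        MvPolynomial.C Polynomial.X * R * MvPolynomial.X i, ?_⟩
      rw [map_mul, hR, hX, if_pos rfl]
      simp only [MvPolynomial.pderiv_mul, MvPolynomial.pderiv_X_self, map_add, map_mul,
        MvPolynomial.map_X, mul_one, map_pow]
      ring
    · refine ⟨R * MvPolynomial.X l, ?_⟩
      rw [map_mul, hR, hX, if_neg h]
      simp only [MvPolynomial.pderiv_mul, MvPolynomial.pderiv_X_of_ne h, map_mul,
        MvPolynomial.map_X, mul_zero, add_zero]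
      ring

theorem aeval_coeff_coordsOver_transvection (i j : Fin n) (z : k) (f : MvPolynomial (Fin n) k)
    (m : Fin n →₀ ℕ) : Polynomial.aeval z
      ((coordsOver (Matrix.transvection i j (Polynomial.X : Polynomial k)) f).coeff m) =
        (coordsOver (Matrix.transvection i j z) f).coeff m := by
  have e : (Matrix.transvection i j (Polynomial.X : Polynomial k)).map
      (Polynomial.aeval z : Polynomial k →ₐ[k] k) = Matrix.transvection i j z := by
    ext i' j'
    rw [Matrix.map_apply, Matrix.transvection, Matrix.transvection, Matrix.add_apply,
      Matrix.add_apply, map_add, Matrix.one_apply, Matrix.one_apply, Matrix.single_apply,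
      Matrix.single_apply, apply_ite (Polynomial.aeval z : Polynomial k →ₐ[k] k),
      apply_ite (Polynomial.aeval z : Polynomial k →ₐ[k] k), map_one, map_zero, Polynomial.aeval_X]
  rw [coeff_coordsOver, e]

theorem coeff_X_mul_pderiv {i j : Fin n} (hij : i ≠ j) (f : MvPolynomial (Fin n) k)
    (m : Fin n →₀ ℕ) : (MvPolynomial.X i * MvPolynomial.pderiv j f).coeff m =
      if m i = 0 then 0 else
        f.coeff (m - Finsupp.single i 1 + Finsupp.single j 1) * (m j + 1) := by
  classical
  rw [MvPolynomial.coeff_X_mul']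
  split_ifs with h1 h2 h2
  · simp [h2] at h1
  · rw [MvPolynomial.coeff_pderiv]
    simp [hij.symm]
  · rfl
  · exact absurd (Finsupp.mem_support_iff.2 h2) h1

/-- The coefficients of `x_i ∂_j f` beyond the move of the leading exponent of `f` vanish. -/
theorem coeff_X_mul_pderiv_eq_zero {i j : Fin n} (hij : i < j) {f : MvPolynomial (Fin n) k}
    {u m : Fin n →₀ ℕ} (hj : u j ≠ 0) (hf : ∀ m', toLex u < toLex m' → f.coeff m' = 0)
    (hm : toLex (u - Finsupp.single j 1 + Finsupp.single i 1) < toLex m) :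
    (MvPolynomial.X i * MvPolynomial.pderiv j f).coeff m = 0 := by
  rw [coeff_X_mul_pderiv hij.ne]
  split_ifs with h0
  · rfl
  rw [hf, zero_mul]
  -- Moving exponents by the same amount preserves the lexicographic order.
  have h1 : u - Finsupp.single j 1 + Finsupp.single j 1 = u :=
    tsub_add_cancel_of_le (Finsupp.single_le_iff.2 (Nat.one_le_iff_ne_zero.2 hj))
  have h2 : m - Finsupp.single i 1 + Finsupp.single i 1 = m :=
    tsub_add_cancel_of_le (Finsupp.single_le_iff.2 (Nat.one_le_iff_ne_zero.2 h0))
  rw [← h2] at hm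
  rw [← h1]
  have h3 : toLex (u - Finsupp.single j 1) < toLex (m - Finsupp.single i 1) := by
    exact lt_of_add_lt_add_right (a := toLex (Finsupp.single i 1)) hm
  exact add_lt_add_left h3 (toLex (Finsupp.single j 1))

/-- Exponents of the degree of `v` that are lexicographically at least `v`. -/
noncomputable def upperSegment (v : Fin n →₀ ℕ) : Finset (Fin n →₀ ℕ) :=
  open Classical in
  (Finsupp.finite_of_degree_eq (σ := Fin n) v.degree).toFinset.filter fun m => toLex v ≤ toLex m

theorem mem_upperSegment {v m : Fin n →₀ ℕ} :
    m ∈ upperSegment v ↔ m.degree = v.degree ∧ toLex v ≤ toLex m := by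
  simp [upperSegment]

theorem isFinalSegment_upperSegment (v : Fin n →₀ ℕ) :
    IsFinalSegment (upperSegment v) v.degree where
  degree_eq _ hm := (mem_upperSegment.1 hm).1
  mem_of_le _ hm _ hd hle := mem_upperSegment.2 ⟨hd, (mem_upperSegment.1 hm).2.trans hle⟩

theorem isFinalSegment_upperSegment_erase (v : Fin n →₀ ℕ) :
    IsFinalSegment ((upperSegment v).erase v) v.degree where
  degree_eq m hm := (mem_upperSegment.1 (Finset.mem_of_mem_erase hm)).1
  mem_of_le m hm m' hd hle := by
    rw [Finset.mem_erase, mem_upperSegment] at hm ⊢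
    refine ⟨?_, hd, hm.2.2.trans hle⟩
    rintro rfl
    exact hm.1 (toLex.injective (le_antisymm hle hm.2.2))

/-- The counts in final segments determine the leading exponents. -/
theorem mem_leadingExponents_iff_leadingCount_lt (V : Ideal (MvPolynomial (Fin n) k))
    (v : Fin n →₀ ℕ) :
    v ∈ leadingExponents V ↔
      leadingCount V ((upperSegment v).erase v) < leadingCount V (upperSegment v) := by
  classical
  have hv : v ∈ upperSegment v := mem_upperSegment.2 ⟨rfl, le_rfl⟩
  have key : leadingCount V (upperSegment v) = leadingCount V ((upperSegment v).erase v) +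
      if v ∈ leadingExponents V then 1 else 0 := by
    unfold leadingCount
    conv_lhs => rw [← Finset.insert_erase hv]
    rw [Finset.filter_insert]
    split_ifs with h
    · rw [Finset.card_insert_of_notMem (by simp)]
    · rfl
  rw [key]
  split_ifs with h <;> simp [h]

/-- In generic coordinates the leading exponents are closed under moving exponents to larger
variables: otherwise an infinitesimal transvection would create one more leading exponent. -/
theorem IsGenericFor.move_mem [CharZero k] {I : Ideal (MvPolynomial (Fin n) k)}
    (hI : IsHomogeneousIdeal I) {g : GL (Fin n) k} {u : Fin n →₀ ℕ} {i j : Fin n} (hij : i < j)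
    (hj : u j ≠ 0)
    (hg : IsGenericFor I (upperSegment (u - Finsupp.single j 1 + Finsupp.single i 1)) g)
    (hu : u ∈ leadingExponents (transform g I)) :
    u - Finsupp.single j 1 + Finsupp.single i 1 ∈ leadingExponents (transform g I) := by
  classical
  set u' := u - Finsupp.single j 1 + Finsupp.single i 1 with hu'
  have hdeg : u'.degree = u.degree := degree_move hj i
  have hlt : toLex u < toLex u' := toLex_lt_move hij
  set V := transform g I
  have hV : IsHomogeneousIdeal V := transform_isHomogeneous g hI
  by_contra hcon
  set T := (upperSegment u').filter (· ∈ leadingExponents V) with hT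
  have hTA : ∀ t ∈ T, t ∈ upperSegment u' := fun t ht => (Finset.mem_filter.1 ht).1
  obtain ⟨f, h1, h2, h3, h4⟩ := exists_forms hV T (d := u'.degree)
    (fun t ht => (mem_upperSegment.1 (hTA t ht)).1) (fun t ht => (Finset.mem_filter.1 ht).2)
  obtain ⟨w, w1, w2, w3, w4⟩ := (mem_leadingExponents_iff hV).1 hu
  rw [← hdeg] at w2
  let F : Option T → MvPolynomial (Fin n) k := fun y => y.elim w f
  let a : Option T → Fin n →₀ ℕ := fun x => x.elim u' Subtype.val
  have haA : ∀ x, a x ∈ upperSegment u' := by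
    rintro (_ | t)
    · exact mem_upperSegment.2 ⟨rfl, le_rfl⟩
    · exact hTA t.1 t.2
  have hFV : ∀ y, F y ∈ V := by rintro (_ | t); exacts [w1, h1 t]
  have hFd : ∀ y, (F y).IsHomogeneous u'.degree := by rintro (_ | t); exacts [w2, h2 t]
  have hainj : Function.Injective fun x => toLex (a x) := by
    refine toLex.injective.comp ?_
    rintro (_ | t) (_ | t') h
    · rfl
    · have h' : u' = t'.1 := h
      exact absurd (h'.symm ▸ (Finset.mem_filter.1 t'.2).2) hcon
    · have h' : t.1 = u' := h
      exact absurd (h' ▸ (Finset.mem_filter.1 t.2).2) hcon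
    · exact congrArg some (Subtype.ext h)
  let B : MvPolynomial (Fin n) k →ₐ[k] MvPolynomial (Fin n) (Polynomial k) :=
    coordsOver (Matrix.transvection i j (Polynomial.X : Polynomial k))
  obtain ⟨R, hR⟩ := exists_coordsOver_transvection i j w
  let N : Matrix (Option T) (Option T) (Polynomial k) := Matrix.of fun x y => (B (F y)).coeff (a x)
  -- The column of `w` is divisible by `X`; `N'` is obtained by dividing it out.
  let N' : Matrix (Option T) (Option T) (Polynomial k) := Matrix.of fun x y =>
    y.elim (Polynomial.C ((MvPolynomial.X i * MvPolynomial.pderiv j w).coeff (a x)) +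
      Polynomial.X * R.coeff (a x)) fun t => (B (f t)).coeff (a x)
  let c : Option T → Polynomial k := fun y => y.elim Polynomial.X fun _ => 1
  have hN : N = Matrix.of fun x y => c y * N' x y := by
    ext1 x y
    rcases y with _ | t
    · have hx : w.coeff (a x) = 0 :=
        w4 _ (hlt.trans_le (mem_upperSegment.1 (haA x)).2)
      change (B w).coeff (a x) = Polynomial.X * (Polynomial.C _ + Polynomial.X * R.coeff (a x))
      rw [show B w = _ from hR]
      simp only [MvPolynomial.coeff_add, MvPolynomial.coeff_C_mul, MvPolynomial.coeff_map, hx,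
        map_zero]
      ring
    · change (B (f t)).coeff (a x) = 1 * (B (f t)).coeff (a x)
      rw [one_mul]
  have hN'0 : (Polynomial.aeval (0 : k) : Polynomial k →ₐ[k] k) N'.det ≠ 0 := by
    have hB0 : ∀ (x : Option T) (h : MvPolynomial (Fin n) k),
        (Polynomial.aeval (0 : k) : Polynomial k →ₐ[k] k) ((B h).coeff (a x)) = h.coeff (a x) := by
      intro x h
      rw [aeval_coeff_coordsOver_transvection, Matrix.transvection_zero]
      exact congrArg _ (changeCoords_one_apply h)
    have hnone : ∀ x, (Polynomial.aeval (0 : k) : Polynomial k →ₐ[k] k) (N' x none) =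
        (MvPolynomial.X i * MvPolynomial.pderiv j w).coeff (a x) := by
      intro x
      simp [N']
    rw [AlgHom.map_det, det_eq_prod_of_key _ hainj, Finset.prod_ne_zero_iff]
    · rintro (_ | t) -
      · rw [AlgHom.mapMatrix_apply, Matrix.map_apply, hnone]
        change (MvPolynomial.X i * MvPolynomial.pderiv j w).coeff u' ≠ 0
        have e1 : u' i ≠ 0 := by simp [hu']
        have e2 : u' - Finsupp.single i 1 + Finsupp.single j 1 = u := by
          rw [hu', add_tsub_cancel_right]
          exact tsub_add_cancel_of_le (Finsupp.single_le_iff.2 (Nat.one_le_iff_ne_zero.2 hj))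
        rw [coeff_X_mul_pderiv hij.ne, if_neg e1, e2, w3, one_mul]
        exact_mod_cast (u' j).succ_ne_zero
      · rw [AlgHom.mapMatrix_apply, Matrix.map_apply]
        change (Polynomial.aeval (0 : k) : Polynomial k →ₐ[k] k) ((B (f t)).coeff (a (some t))) ≠ 0
        rw [hB0]
        change (f t).coeff t.1 ≠ 0
        rw [h3]; exact one_ne_zero
    · rintro x (_ | t) hxy
      · rw [AlgHom.mapMatrix_apply, Matrix.map_apply, hnone]
        exact coeff_X_mul_pderiv_eq_zero hij hj w4 hxy
      · rw [AlgHom.mapMatrix_apply, Matrix.map_apply]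
        change (Polynomial.aeval (0 : k) : Polynomial k →ₐ[k] k) ((B (f t)).coeff (a x)) = 0
        rw [hB0]
        exact h4 t _ hxy
  have hNdet : N.det ≠ 0 := by
    rw [hN, Matrix.det_mul_row]
    refine mul_ne_zero (Finset.prod_ne_zero_iff.2 ?_) ?_
    · rintro (_ | t) -
      · exact Polynomial.X_ne_zero
      · exact one_ne_zero
    · intro h0
      rw [h0, map_zero] at hN'0
      exact hN'0 rfl
  obtain ⟨z, hz⟩ : ∃ z : k, N.det.eval z ≠ 0 := by
    by_contra! h0
    exact hNdet (Polynomial.funext fun z => by rw [h0 z, Polynomial.eval_zero])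
  let b : GL (Fin n) k := Matrix.GeneralLinearGroup.mkOfDetNeZero (Matrix.transvection i j z) (by
    rw [Matrix.det_transvection_of_ne i j hij.ne]; exact one_ne_zero)
  have hNz : (Matrix.of fun x y => (changeCoords b (F y)).coeff (a x)) =
      (Polynomial.aeval z : Polynomial k →ₐ[k] k).mapMatrix N := by
    ext x y
    exact (aeval_coeff_coordsOver_transvection i j z (F y) (a x)).symm
  have hcount := card_le_leadingCount (V := transform (b * g) I)
    (isFinalSegment_upperSegment u') (h := fun y => changeCoords b (F y))
    (fun y => changeCoords_mem_transform_mul b g (hFV y))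
    (fun y => changeCoords_isHomogeneous b (hFd y)) haA (by
      rw [hNz, ← AlgHom.map_det, Polynomial.coe_aeval_eq_eval]
      exact hz)
  have hmax := hcount.trans (hg (b * g))
  rw [Fintype.card_option, Fintype.card_coe] at hmax
  have : leadingCount (transform g I) (upperSegment u') = T.card := leadingCount_eq _ _
  omega


/-! ### Zariski open subsets of the general linear group -/

/-- The general linear group over an infinite field is Zariski dense in the space of matrices. -/
theorem exists_evalGL_ne_zero [Infinite k] {p : MvPolynomial (Fin n × Fin n) k} (hp : p ≠ 0) :
    ∃ g : GL (Fin n) k, evalGL g p ≠ 0 := by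
  by_contra! hc
  refine mul_ne_zero hp (Matrix.det_mvPolynomialX_ne_zero (Fin n) k)
    (MvPolynomial.funext fun s => ?_)
  rw [map_mul, map_zero, Matrix.eval_det_mvPolynomialX]
  by_cases hs : (Matrix.of (Function.curry s)).det = 0
  · exact mul_eq_zero_of_right _ hs
  · exact mul_eq_zero_of_left (hc (Matrix.GeneralLinearGroup.mkOfDetNeZero _ hs)) _

theorem isZariskiOpen_evalGL_ne_zero (p : MvPolynomial (Fin n × Fin n) k) :
    IsZariskiOpen {g : GL (Fin n) k | evalGL g p ≠ 0} :=
  ⟨{p}, by simp⟩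

theorem isZariskiDense_evalGL_ne_zero [Infinite k] {p : MvPolynomial (Fin n × Fin n) k}
    (hp : p ≠ 0) : IsZariskiDense {g : GL (Fin n) k | evalGL g p ≠ 0} := by
  rintro _ ⟨T, rfl⟩ ⟨g₀, q, hq, hg₀⟩
  have hq0 : q ≠ 0 := by
    rintro rfl
    exact hg₀ (map_zero _)
  obtain ⟨g, hg⟩ := exists_evalGL_ne_zero (mul_ne_zero hp hq0)
  rw [evalGL, map_mul] at hg
  exact ⟨g, left_ne_zero_of_mul hg, q, hq, right_ne_zero_of_mul hg⟩

theorem IsGin.unique {τ : MonomialOrder (Fin n)} {I J J' : Ideal (MvPolynomial (Fin n) k)}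
    (hJ : IsGin τ I J) (hJ' : IsGin τ I J') : J = J' := by
  obtain ⟨U, -, hU, h⟩ := hJ
  obtain ⟨U', hU'o, hU', h'⟩ := hJ'
  have huniv : IsZariskiOpen (Set.univ : Set (GL (Fin n) k)) := ⟨{1}, by simp⟩
  obtain ⟨g', hg', -⟩ := hU' _ huniv Set.univ_nonempty
  obtain ⟨g, hg, hg'⟩ := hU _ hU'o ⟨g', hg'⟩
  rw [← h g hg, h' g hg']

/-! ### Points in general coordinates -/

theorem eval_smul_of_isHomogeneous {f : MvPolynomial (Fin n) k} {d : ℕ} (hf : f.IsHomogeneous d)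
    (c : k) (v : Fin n → k) :
    MvPolynomial.eval (c • v) f = c ^ d * MvPolynomial.eval v f := by
  rw [MvPolynomial.eval_eq', MvPolynomial.eval_eq', Finset.mul_sum]
  refine Finset.sum_congr rfl fun m hm => ?_
  have hd : m.degree = d := by
    by_contra hne
    exact MvPolynomial.mem_support_iff.1 hm (hf.coeff_eq_zero hne)
  simp only [Pi.smul_apply, smul_eq_mul, mul_pow, Finset.prod_mul_distrib,
    Finset.prod_pow_eq_pow_sum]
  rw [← Finsupp.degree_eq_sum, hd]
  ring

theorem mem_idealOfPoints_iff (X : Set (ℙ k (Fin n → k))) {f : MvPolynomial (Fin n) k} {d : ℕ}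
    (hf : f.IsHomogeneous d) :
    f ∈ idealOfPoints X ↔ ∀ a ∈ X, MvPolynomial.eval a.rep f = 0 := by
  constructor
  · intro h a ha
    clear hf
    induction h using Submodule.span_induction with
    | mem f hf => exact hf.2 a.rep a.rep_nonzero (by rwa [a.mk_rep])
    | zero => exact map_zero _
    | add f g _ _ hf hg => rw [map_add, hf, hg, add_zero]
    | smul q f _ hf => rw [smul_eq_mul, map_mul, hf, mul_zero]
  · intro h
    refine Submodule.subset_span ⟨⟨d, hf⟩, fun v hv hX => ?_⟩
    obtain ⟨c, hc⟩ := Projectivization.exists_smul_eq_mk_rep k v hv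
    have h1 := h _ hX
    rw [← hc, Units.smul_def, eval_smul_of_isHomogeneous hf] at h1
    exact (mul_eq_zero.1 h1).resolve_left (pow_ne_zero _ c.ne_zero)

theorem idealOfPoints_isHomogeneousIdeal (X : Set (ℙ k (Fin n → k))) :
    IsHomogeneousIdeal (idealOfPoints X) :=
  ⟨_, fun _ hf => hf.1, rfl⟩

/-- The coordinates of the vector `v`, regarded as a point, in the coordinate system changed
by `g`. -/
noncomputable def newCoords (g : GL (Fin n) k) (v : Fin n → k) : Fin n → k :=
  ((g⁻¹ : GL (Fin n) k) : Matrix (Fin n) (Fin n) k).transpose.mulVec v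

theorem mem_transform_idealOfPoints_iff (X : Set (ℙ k (Fin n → k))) (g : GL (Fin n) k)
    {f : MvPolynomial (Fin n) k} {d : ℕ} (hf : f.IsHomogeneous d) :
    f ∈ transform g (idealOfPoints X) ↔
      ∀ a ∈ X, MvPolynomial.eval (newCoords g a.rep) f = 0 := by
  rw [mem_transform_iff, mem_idealOfPoints_iff X (changeCoords_isHomogeneous _ hf)]
  simp only [eval_changeCoords, newCoords]

/-- The coordinates `newCoords g v` up to the factor `det g`, as polynomials in the entries
of `g`. -/
noncomputable def newCoordsPoly (v : Fin n → k) (i : Fin n) : MvPolynomial (Fin n × Fin n) k :=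
  ∑ l, (Matrix.mvPolynomialX (Fin n) (Fin n) k).adjugate l i * MvPolynomial.C (v l)

theorem evalGL_newCoordsPoly (g : GL (Fin n) k) (v : Fin n → k) (i : Fin n) :
    evalGL g (newCoordsPoly v i) =
      (g : Matrix (Fin n) (Fin n) k).det * newCoords g v i := by
  have h1 : (g : Matrix (Fin n) (Fin n) k).adjugate =
      (g : Matrix (Fin n) (Fin n) k).det • ((g⁻¹ : GL (Fin n) k) : Matrix (Fin n) (Fin n) k) := by
    have h2 := Matrix.adjugate_mul (g : Matrix (Fin n) (Fin n) k)
    have h3 := congrArg (· * ((g⁻¹ : GL (Fin n) k) : Matrix (Fin n) (Fin n) k)) h2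
    simpa [mul_assoc] using h3
  have h4 : ∀ l, evalGL g ((Matrix.mvPolynomialX (Fin n) (Fin n) k).adjugate l i) =
      (g : Matrix (Fin n) (Fin n) k).adjugate l i := by
    intro l
    have h5 := RingHom.map_adjugate (MvPolynomial.eval fun ij : Fin n × Fin n => g ij.1 ij.2)
      (Matrix.mvPolynomialX (Fin n) (Fin n) k)
    have h6 : (MvPolynomial.eval fun ij : Fin n × Fin n => g ij.1 ij.2).mapMatrix
        (Matrix.mvPolynomialX (Fin n) (Fin n) k) = (g : Matrix (Fin n) (Fin n) k) := by
      ext a b; simp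
    rw [h6] at h5
    exact congrFun (congrFun h5 l) i
  simp only [evalGL] at h4
  simp only [evalGL, newCoordsPoly, map_sum, map_mul, h4, h1, MvPolynomial.eval_C, newCoords,
    Matrix.mulVec, dotProduct, Matrix.transpose_apply, Matrix.smul_apply, smul_eq_mul,
    Finset.mul_sum, mul_assoc]

/-- The coordinates of `h *ᵥ v` as polynomials in the entries of `h`. -/
noncomputable def mulVecPoly (v : Fin n → k) (i : Fin n) : MvPolynomial (Fin n × Fin n) k :=
  ∑ l, MvPolynomial.X (i, l) * MvPolynomial.C (v l)

theorem eval_mulVecPoly (s : Fin n × Fin n → k) (v : Fin n → k) (i : Fin n) :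
    MvPolynomial.eval s (mulVecPoly v i) = ∑ l, s (i, l) * v l := by
  simp [mulVecPoly]

theorem exists_newCoords_eq (h : GL (Fin n) k) : ∃ g : GL (Fin n) k, ∀ v i,
    newCoords g v i = evalGL h (mulVecPoly v i) := by
  let t : GL (Fin n) k := Matrix.GeneralLinearGroup.mkOfDetNeZero
    (h : Matrix (Fin n) (Fin n) k).transpose (by
      rw [Matrix.det_transpose]
      exact ((Matrix.isUnit_iff_isUnit_det _).1 h.isUnit).ne_zero)
  refine ⟨t⁻¹, fun v i => ?_⟩
  rw [evalGL, eval_mulVecPoly, newCoords, inv_inv]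
  rfl

theorem newCoordsPoly_ne_zero [Infinite k] {v : Fin n → k} (hv : v ≠ 0) (q : Fin n) :
    newCoordsPoly v q ≠ 0 := by
  classical
  obtain ⟨l, hl⟩ := Function.ne_iff.1 hv
  obtain ⟨h, hh⟩ := exists_evalGL_ne_zero (n := n) (p := mulVecPoly v q) (by
    intro h0
    have := eval_mulVecPoly (fun x => if x.2 = l then 1 else 0) v q
    rw [h0] at this
    simp at this
    exact hl this.symm)
  obtain ⟨g, hg⟩ := exists_newCoords_eq h
  intro h0
  have h1 := evalGL_newCoordsPoly g v q
  rw [h0, evalGL, map_zero, hg] at h1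
  exact mul_ne_zero ((Matrix.isUnit_iff_isUnit_det _).1 g.isUnit).ne_zero hh h1.symm

/-- The minor of the coordinates `p` and `q` of two vectors, up to the factor `det g ^ 2`, as a
polynomial in the entries of `g`. -/
noncomputable def minorPoly (p q : Fin n) (v v' : Fin n → k) : MvPolynomial (Fin n × Fin n) k :=
  newCoordsPoly v p * newCoordsPoly v' q - newCoordsPoly v' p * newCoordsPoly v q

theorem evalGL_minorPoly (g : GL (Fin n) k) (p q : Fin n) (v v' : Fin n → k) :
    evalGL g (minorPoly p q v v') = (g : Matrix (Fin n) (Fin n) k).det ^ 2 *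
      (newCoords g v p * newCoords g v' q - newCoords g v' p * newCoords g v q) := by
  have h := evalGL_newCoordsPoly g
  simp only [evalGL] at h
  simp only [evalGL, minorPoly, map_sub, map_mul, h]
  ring

theorem minorPoly_ne_zero [Infinite k] {p q : Fin n} (hpq : p ≠ q) {a b : ℙ k (Fin n → k)}
    (hab : a ≠ b) : minorPoly p q a.rep b.rep ≠ 0 := by
  classical
  obtain ⟨i, j, hij⟩ : ∃ i j, a.rep i * b.rep j - b.rep i * a.rep j ≠ 0 := by
    by_contra! hc
    obtain ⟨j, hj⟩ := Function.ne_iff.1 a.rep_nonzero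
    refine hab ?_
    rw [← a.mk_rep, ← b.mk_rep, eq_comm, Projectivization.mk_eq_mk_iff']
    refine ⟨b.rep j / a.rep j, funext fun i => ?_⟩
    rw [Pi.smul_apply, smul_eq_mul, div_mul_eq_mul_div, div_eq_iff hj]
    linear_combination hc i j
  obtain ⟨h, hh⟩ := exists_evalGL_ne_zero (n := n)
    (p := mulVecPoly a.rep p * mulVecPoly b.rep q - mulVecPoly b.rep p * mulVecPoly a.rep q) (by
    intro h0
    have := congrArg (MvPolynomial.eval (fun x : Fin n × Fin n =>
      if x = (p, i) ∨ x = (q, j) then (1 : k) else 0)) h0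
    rw [map_sub, map_mul, map_mul, eval_mulVecPoly, eval_mulVecPoly, eval_mulVecPoly,
      eval_mulVecPoly, map_zero] at this
    simp [hpq, hpq.symm] at this
    exact hij this)
  obtain ⟨g, hg⟩ := exists_newCoords_eq h
  intro h0
  have h1 := evalGL_minorPoly g p q a.rep b.rep
  rw [h0, evalGL, map_zero] at h1
  refine mul_ne_zero (pow_ne_zero 2 ((Matrix.isUnit_iff_isUnit_det _).1 g.isUnit).ne_zero) ?_
    h1.symm
  simp only [evalGL, map_sub, map_mul] at hh
  simpa only [hg] using hh

/-- In generic coordinates a finite set of points lies off the hyperplane `x_q = 0` and projects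
injectively to the coordinates `p` and `q`. -/
theorem exists_generalPosition [Infinite k] {p q : Fin n} (hpq : p ≠ q)
    (X : Finset (ℙ k (Fin n → k))) :
    ∃ P : MvPolynomial (Fin n × Fin n) k, P ≠ 0 ∧ ∀ g, evalGL g P ≠ 0 →
      ∃ y : X → Fin n → k, (∀ a, y a q = 1) ∧ (Function.Injective fun a => y a p) ∧
        ∀ (f : MvPolynomial (Fin n) k) (d : ℕ), f.IsHomogeneous d →
          (f ∈ transform g (idealOfPoints (X : Set (ℙ k (Fin n → k)))) ↔
            ∀ a, MvPolynomial.eval (y a) f = 0) := by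
  classical
  refine ⟨(∏ a ∈ X, newCoordsPoly a.rep q) *
    ∏ x ∈ X.offDiag, minorPoly p q x.1.rep x.2.rep, ?_, ?_⟩
  · refine mul_ne_zero (Finset.prod_ne_zero_iff.2 fun a _ => newCoordsPoly_ne_zero a.rep_nonzero q)
      (Finset.prod_ne_zero_iff.2 fun x hx => minorPoly_ne_zero hpq (Finset.mem_offDiag.1 hx).2.2)
  intro g hg
  rw [evalGL, map_mul, map_prod, map_prod] at hg
  have hq : ∀ a : X, newCoords g a.1.rep q ≠ 0 := by
    intro a h0
    have h1 := Finset.prod_ne_zero_iff.1 (left_ne_zero_of_mul hg) a.1 a.2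
    exact h1 ((evalGL_newCoordsPoly g _ _).trans (by rw [h0, mul_zero]))
  refine ⟨fun a => (newCoords g a.1.rep q)⁻¹ • newCoords g a.1.rep, ?_, ?_, ?_⟩
  · intro a
    exact inv_mul_cancel₀ (hq a)
  · intro a b hab
    by_contra hne
    have h1 := Finset.prod_ne_zero_iff.1 (right_ne_zero_of_mul hg) (a.1, b.1)
      (Finset.mem_offDiag.2 ⟨a.2, b.2, fun h => hne (Subtype.ext h)⟩)
    refine h1 ((evalGL_minorPoly g _ _ _ _).trans ?_)
    simp only [Pi.smul_apply, smul_eq_mul] at hab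
    have ha := hq a
    have hb := hq b
    field_simp at hab
    rw [mul_eq_zero]
    right
    linear_combination hab
  · intro f d hf
    rw [mem_transform_idealOfPoints_iff _ g hf]
    constructor
    · intro h a
      rw [eval_smul_of_isHomogeneous hf, h a.1 a.2, mul_zero]
    · intro h a ha
      have h1 := h ⟨a, ha⟩
      rw [eval_smul_of_isHomogeneous hf] at h1
      exact (mul_eq_zero.1 h1).resolve_left (pow_ne_zero _ (inv_ne_zero (hq ⟨a, ha⟩)))


/-! ### The regularity of the generic initial ideal -/

/-- The degree of a minimal generator of a monomial ideal is a lower bound for the regularity. -/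
theorem degree_le_of_isRegular {L : Set (Fin n →₀ ℕ)} {m : Fin n →₀ ℕ}
    (hm : Minimal (· ∈ L) m) {e : ℤ}
    (h : IsRegular (Ideal.span ((fun m => MvPolynomial.monomial m (1 : k)) '' L)) e) :
    (m.degree : ℤ) ≤ e := by
  classical
  obtain ⟨F, hF⟩ := h
  have h1 : MvPolynomial.monomial m (1 : k) ∈ LinearMap.range F.aug := by
    rw [F.range_aug]
    exact Ideal.subset_span ⟨m, hm.prop, rfl⟩
  obtain ⟨z, hz⟩ := h1
  have hz' : F.aug z = ∑ j, z j * F.aug (Pi.single j 1) := by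
    conv_lhs => rw [pi_eq_sum_univ' z, map_sum]
    refine Finset.sum_congr rfl fun j _ => ?_
    rw [map_smul, smul_eq_mul]
  have h2 : m ∈ (∑ j, z j * F.aug (Pi.single j 1)).support := by
    rw [← hz', hz]; simp
  obtain ⟨j, -, hj⟩ := Finset.mem_biUnion.1 (MvPolynomial.support_sum h2)
  obtain ⟨a, -, b, hb, hab⟩ := Finset.mem_add.1 (MvPolynomial.support_mul _ _ hj)
  have hbm : b ≤ m := hab ▸ le_add_self
  have h3 : F.aug (Pi.single j 1) ∈
      Ideal.span ((fun m => MvPolynomial.monomial m (1 : k)) '' L) := by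
    have h := LinearMap.mem_range_self F.aug (Pi.single j 1)
    rwa [F.range_aug] at h
  obtain ⟨v, hv, hvb⟩ := MvPolynomial.mem_ideal_span_monomial_image.1 h3 b hb
  have h4 : b = m := le_antisymm hbm (hm.eq_of_le hv (hvb.trans hbm) ▸ hvb)
  have h5 := F.aug_isForm j b hb
  rw [← h4, h5]
  simpa using hF 0 j

/-- In generic coordinates the leading exponents of the ideal of `s` points are strongly stable,
coincide with `tailExponents` in degrees at least `s`, and do not depend on the coordinates. -/
theorem exists_generic_leadingExponents [CharZero k] {p q : Fin n} (hpq : p < q)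
    (hq : ∀ i, i ≠ q → i ≤ p) (X : Finset (ℙ k (Fin n → k))) :
    ∃ P : MvPolynomial (Fin n × Fin n) k, P ≠ 0 ∧ ∃ L : Set (Fin n →₀ ℕ), StronglyStable L ∧
      L ⊆ tailExponents p X.card ∧ (∀ m ∈ tailExponents p X.card, X.card ≤ m.degree → m ∈ L) ∧
      ∀ g, evalGL g P ≠ 0 →
        leadingExponents (transform g (idealOfPoints (X : Set (ℙ k (Fin n → k))))) = L := by
  classical
  set I := idealOfPoints (X : Set (ℙ k (Fin n → k))) with hI'
  have hI : IsHomogeneousIdeal I := idealOfPoints_isHomogeneousIdeal _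
  obtain ⟨P₀, hP₀, hgp⟩ := exists_generalPosition hpq.ne X
  choose P₁ hP₁ hgen₁ using fun v => exists_isGenericFor hI (isFinalSegment_upperSegment v)
  choose P₂ hP₂ hgen₂ using fun v => exists_isGenericFor hI (isFinalSegment_upperSegment_erase v)
  let D : Finset (Fin n →₀ ℕ) := (Finsupp.finite_of_degree_lt (σ := Fin n) X.card).toFinset
  have hD : ∀ v, v ∈ D ↔ v.degree < X.card := by simp [D]
  have hsub : ∀ g, evalGL g P₀ ≠ 0 → leadingExponents (transform g I) ⊆
      tailExponents p X.card := by
    intro g hg m hm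
    obtain ⟨y, h1, h2, h3⟩ := hgp g hg
    have := mem_tailExponents_of_mem_leadingExponents hpq hq h1 h2 h3
      (transform_isHomogeneous g hI) hm
    rwa [Fintype.card_coe] at this
  have hsup : ∀ g, evalGL g P₀ ≠ 0 → ∀ m ∈ tailExponents p X.card, X.card ≤ m.degree →
      m ∈ leadingExponents (transform g I) := by
    intro g hg m hm hd
    obtain ⟨y, h1, h2, h3⟩ := hgp g hg
    rw [← Fintype.card_coe] at hm hd
    exact mem_leadingExponents_of_mem_tailExponents hpq hq h1 h2 h3
      (transform_isHomogeneous g hI) hm hd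
  have hsplit : ∀ g, evalGL g (P₀ * ∏ v ∈ D, P₁ v * P₂ v) ≠ 0 → evalGL g P₀ ≠ 0 ∧
      ∀ v, v.degree < X.card → IsGenericFor I (upperSegment v) g ∧
        IsGenericFor I ((upperSegment v).erase v) g := by
    intro g hg
    simp only [evalGL, map_mul, map_prod] at hg
    refine ⟨left_ne_zero_of_mul hg, fun v hv => ?_⟩
    have h1 := Finset.prod_ne_zero_iff.1 (right_ne_zero_of_mul hg) v ((hD v).2 hv)
    exact ⟨hgen₁ v g (left_ne_zero_of_mul h1), hgen₂ v g (right_ne_zero_of_mul h1)⟩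
  have hP : P₀ * ∏ v ∈ D, P₁ v * P₂ v ≠ 0 :=
    mul_ne_zero hP₀ (Finset.prod_ne_zero_iff.2 fun v _ => mul_ne_zero (hP₁ v) (hP₂ v))
  obtain ⟨g₀, hg₀⟩ := exists_evalGL_ne_zero hP
  obtain ⟨h₀, hgen₀⟩ := hsplit g₀ hg₀
  refine ⟨_, hP, leadingExponents (transform g₀ I), ?_, hsub g₀ h₀, hsup g₀ h₀, ?_⟩
  · intro u hu i j hij hj
    rcases lt_or_ge u.degree X.card with hd | hd
    · exact (hgen₀ _ ((degree_move hj i).trans_lt hd)).1.move_mem hI hij hj hu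
    · exact hsup g₀ h₀ _ (tailExponents_stronglyStable hpq hq _ u (hsub g₀ h₀ hu) i j hij hj)
        (hd.trans_eq (degree_move hj i).symm)
  · intro g hg
    obtain ⟨h, hgen⟩ := hsplit g hg
    ext v
    rcases lt_or_ge v.degree X.card with hd | hd
    · rw [mem_leadingExponents_iff_leadingCount_lt, mem_leadingExponents_iff_leadingCount_lt,
        le_antisymm ((hgen v hd).1 g₀) ((hgen₀ v hd).1 g),
        le_antisymm ((hgen v hd).2 g₀) ((hgen₀ v hd).2 g)]
    · exact ⟨fun hv => hsup g₀ h₀ v (hsub g h hv) hd, fun hv => hsup g h v (hsub g₀ h₀ hv) hd⟩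

end LexGin

theorem corollary5p3 {k : Type*} [Field k] [IsAlgClosed k] [CharZero k] (r : ℕ) (hr : 1 ≤ r)
    (s : ℕ) (X : Finset (ℙ k (Fin (r + 1) → k))) (hX : X.card = s) :
    (∃! J : Ideal (MvPolynomial (Fin (r + 1)) k),
      LexGin.IsGin MonomialOrder.degLex (LexGin.idealOfPoints (X : Set (ℙ k (Fin (r + 1) → k)))) J) ∧
    ∀ J : Ideal (MvPolynomial (Fin (r + 1)) k),
      LexGin.IsGin MonomialOrder.degLex (LexGin.idealOfPoints (X : Set (ℙ k (Fin (r + 1) → k)))) J →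
        LexGin.HasRegularity J (s : ℤ) := by
  subst hX
  let p : Fin (r + 1) := ⟨r - 1, by omega⟩
  have hpq : p < Fin.last r := by
    rw [Fin.lt_def]
    change r - 1 < r
    omega
  have hq : ∀ i, i ≠ Fin.last r → i ≤ p := by
    intro i hi
    have h1 := Fin.val_lt_last hi
    rw [Fin.le_def]
    change (i : ℕ) ≤ r - 1
    omega
  obtain ⟨P, hP, L, hL, hsub, hsup, hLP⟩ := LexGin.exists_generic_leadingExponents hpq hq X
  set J₀ : Ideal (MvPolynomial (Fin (r + 1)) k) :=
    Ideal.span ((fun m => MvPolynomial.monomial m (1 : k)) '' L)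
  have hgin : LexGin.IsGin MonomialOrder.degLex
      (LexGin.idealOfPoints (X : Set (ℙ k (Fin (r + 1) → k)))) J₀ :=
    ⟨_, LexGin.isZariskiOpen_evalGL_ne_zero P, LexGin.isZariskiDense_evalGL_ne_zero hP,
      fun g hg => by rw [LexGin.initialIdeal_eq_span, hLP g hg]⟩
  refine ⟨⟨J₀, hgin, fun J hJ => hJ.unique hgin⟩, fun J hJ => ?_⟩
  rw [hJ.unique hgin]
  constructor
  · refine hL.isRegular fun m hm => ?_
    -- A generator of larger degree would be a multiple of an element of `L` of smaller degree.
    by_contra! hd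
    obtain ⟨l, hl, hml⟩ := LexGin.exists_sub_single_mem_tailExponents hpq hq (hsub hm.prop) hd
    have h1 : m - Finsupp.single l 1 + Finsupp.single l 1 = m :=
      tsub_add_cancel_of_le (Finsupp.single_le_iff.2 (Nat.one_le_iff_ne_zero.2 hl))
    have h2 := congrArg Finsupp.degree h1
    rw [map_add, Finsupp.degree_single] at h2
    have h3 := hm.eq_of_le (hsup _ hml (by omega)) tsub_le_self
    rw [h3] at h2
    omega
  · intro e he
    -- The pure power `x_{r-1}^s` is a minimal generator.
    have hmin : Minimal (· ∈ L) (Finsupp.single p X.card) := by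
      refine ⟨hsup _ (Or.inr (by simp)) (by simp [Finsupp.degree_single]), fun v hv hle => ?_⟩
      rw [Finsupp.single_le_iff]
      rcases hsub hv with ⟨i, hi, hvi⟩ | h
      · have h1 := hle i
        rw [Finsupp.single_apply, if_neg hi.ne'] at h1
        omega
      · exact h
    have := LexGin.degree_le_of_isRegular hmin he
    rwa [Finsupp.degree_single] at this
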